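/- Theorem (Chen). Let $X:[a,b]\to\mathbb R^d$ ($a\le b$) be a path, that is, a continuous map of bounded variation (in particular, $X$ may be any continuous piecewise continuously differentiable map). For a word $(i_1,\dots,i_k)$ in $\{1,\dots,d\}$ define the iterated integrals recursively as Riemann–Stieltjes integrals: $S(X)^{\emptyset}_{a,t}=1$ and $$S(X)^{i_1,\dots,i_k}_{a,t}=\int_a^t S(X)^{i_1,\dots,i_{k-1}}_{a,s}\,dX^{i_k}_s ,\qquad t\in[a,b].$$ Let $$S(X)_{a,b}=\sum_{k\ge 0}\ \sum_{i_1,\dots,i_k\in\{1,\dots,d\}}S(X)^{i_1,\dots,i_k}_{a,b}\;e_{i_1}\cdots e_{i_k}$$ be the signature of $X$, an element of the algebra of real formal power series in the non-commuting indeterminates $e_1,\dots,e_d$. In this algebra let $[x,y]=xy-yx$ and, for a series $x$ with constant term $\lambda_0>0$, let $$\log x=\log\lambda_0+\sum_{n\ge1}\frac{(-1)^{n-1}}{n}\Bigl(\frac{x}{\lambda_0}-1\Bigr)^{n}.$$ Then all the Riemann–Stieltjes integrals above exist, and there are real numbers $\lambda_{i_1,\dots,i_k}$ ($k\ge1$,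 $i_1,\dots,i_k\in\{1,\dots,d\}$) such that $$\log S(X)_{a,b}=\sum_{k\ge1}\ \sum_{i_1,\dots,i_k\in\{1,\dots,d\}}\lambda_{i_1,\dots,i_k}\,[e_{i_1},[e_{i_2},\dots,[e_{i_{k-1}},e_{i_k}]\dots]],$$ where for $k=1$ the bracket is $e_{i_1}$, and the infinite sums (here and in the definition of $\log$) are taken coefficient by coefficient, each coefficient receiving only finitely many non-zero contributions. -/

import Mathlib

open scoped BigOperators

/-! ### Non-commuting formal power series -/

/-- Formal power series with real coefficients in the `d` non-commuting indeterminates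
`e_1, …, e_d`: a series is the family of its coefficients, where the word `[i₁, …, i_k]` indexes
the coefficient of the monomial `e_{i₁} … e_{i_k}`. -/
def NCSeries (d : ℕ) : Type := List (Fin d) → ℝ

namespace NCSeries

variable {d : ℕ}

noncomputable instance : AddCommGroup (NCSeries d) :=
  inferInstanceAs (AddCommGroup (List (Fin d) → ℝ))

noncomputable instance : Module ℝ (NCSeries d) :=
  inferInstanceAs (Module ℝ (List (Fin d) → ℝ))

/-- The coefficient of the monomial indexed by the word `w`. -/
def coeff (x : NCSeries d) (w : List (Fin d)) : ℝ := x w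

/-- The series with prescribed coefficients. -/
def ofCoeff (c : List (Fin d) → ℝ) : NCSeries d := c

@[simp] theorem coeff_ofCoeff (c : List (Fin d) → ℝ) (w : List (Fin d)) :
    (ofCoeff c).coeff w = c w := rfl

@[ext] theorem ext {x y : NCSeries d} (h : ∀ w, x.coeff w = y.coeff w) : x = y := funext h

@[simp] theorem coeff_zero (w : List (Fin d)) : (0 : NCSeries d).coeff w = 0 := rfl

@[simp] theorem coeff_add (x y : NCSeries d) (w : List (Fin d)) :
    (x + y).coeff w = x.coeff w + y.coeff w := rfl

@[simp] theorem coeff_neg (x : NCSeries d) (w : List (Fin d)) :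
    (-x).coeff w = -x.coeff w := rfl

@[simp] theorem coeff_sub (x y : NCSeries d) (w : List (Fin d)) :
    (x - y).coeff w = x.coeff w - y.coeff w := rfl

@[simp] theorem coeff_smul (r : ℝ) (x : NCSeries d) (w : List (Fin d)) :
    (r • x).coeff w = r * x.coeff w := rfl

/-- The monomial `e_{i₁} … e_{i_k}` of the word `[i₁, …, i_k]`. -/
noncomputable def monomial (v : List (Fin d)) : NCSeries d :=
  ofCoeff fun w => if w = v then 1 else 0

/-- The indeterminate `e_i`. -/
noncomputable def e (i : Fin d) : NCSeries d := monomial [i]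

noncomputable instance : One (NCSeries d) := ⟨monomial []⟩

/-- The product extending concatenation of monomials: the coefficient at `w` sums over all ways to
cut `w` into a prefix and a suffix. -/
noncomputable instance : Mul (NCSeries d) :=
  ⟨fun x y => ofCoeff fun w =>
    ∑ k ∈ Finset.range (w.length + 1), x.coeff (w.take k) * y.coeff (w.drop k)⟩

theorem coeff_one (w : List (Fin d)) :
    (1 : NCSeries d).coeff w = if w = [] then 1 else 0 := rfl

theorem coeff_mul (x y : NCSeries d) (w : List (Fin d)) :
    (x * y).coeff w =
      ∑ k ∈ Finset.range (w.length + 1), x.coeff (w.take k) * y.coeff (w.drop k) := rfl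

theorem coeff_mul_nil (x y : NCSeries d) :
    (x * y).coeff [] = x.coeff [] * y.coeff [] := by
  simp [coeff_mul]

theorem coeff_mul_cons (x y : NCSeries d) (i : Fin d) (w : List (Fin d)) :
    (x * y).coeff (i :: w) = x.coeff [] * y.coeff (i :: w) +
      (ofCoeff (fun v => x.coeff (i :: v)) * y).coeff w := by
  simp only [coeff_mul, List.length_cons]
  rw [Finset.sum_range_succ']
  simp [add_comm]

private theorem add_mul' (x y z : NCSeries d) : (x + y) * z = x * z + y * z := by
  ext w
  simp [coeff_mul, add_mul, Finset.sum_add_distrib]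

private theorem smul_mul' (r : ℝ) (x z : NCSeries d) : (r • x) * z = r • (x * z) := by
  ext w
  simp [coeff_mul, mul_assoc, Finset.mul_sum]

private theorem mul_assoc' (x y z : NCSeries d) : x * y * z = x * (y * z) := by
  ext w
  induction w generalizing x with
  | nil => simp [coeff_mul_nil, mul_assoc]
  | cons i w ih =>
    have h : ofCoeff (fun v => (x * y).coeff (i :: v)) =
        x.coeff [] • ofCoeff (fun v => y.coeff (i :: v)) +
          ofCoeff (fun v => x.coeff (i :: v)) * y := by
      ext v
      simp [coeff_mul_cons x y]
    rw [coeff_mul_cons (x * y), coeff_mul_cons x (y * z), coeff_mul_cons y z, h, add_mul',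
      smul_mul', coeff_mul_nil, coeff_add, coeff_smul, ih]
    ring

private theorem one_mul' (x : NCSeries d) : 1 * x = x := by
  ext w
  cases w with
  | nil => simp [coeff_mul_nil, coeff_one]
  | cons i w =>
    have h : ofCoeff (fun v => (1 : NCSeries d).coeff (i :: v)) = 0 := by
      ext v
      simp [coeff_one]
    rw [coeff_mul_cons, h]
    simp [coeff_one, coeff_mul]

private theorem mul_one' (x : NCSeries d) : x * 1 = x := by
  ext w
  induction w generalizing x with
  | nil => simp [coeff_mul_nil, coeff_one]
  | cons i w ih => simp [coeff_mul_cons, coeff_one, ih]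

noncomputable instance : Ring (NCSeries d) :=
  { (inferInstance : AddCommGroup (NCSeries d)),
    (inferInstance : One (NCSeries d)), (inferInstance : Mul (NCSeries d)) with
    left_distrib := fun x y z => by
      ext w
      simp [coeff_mul, mul_add, Finset.sum_add_distrib]
    right_distrib := add_mul'
    zero_mul := fun x => by
      ext w
      simp [coeff_mul]
    mul_zero := fun x => by
      ext w
      simp [coeff_mul]
    mul_assoc := mul_assoc'
    one_mul := one_mul'
    mul_one := mul_one' }

noncomputable instance : Algebra ℝ (NCSeries d) :=
  Algebra.ofModule smul_mul' (fun r x y => by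
    ext w
    simp [coeff_mul, Finset.mul_sum, mul_left_comm])

theorem coeff_sum {ι : Type*} (s : Finset ι) (f : ι → NCSeries d) (w : List (Fin d)) :
    (∑ i ∈ s, f i).coeff w = ∑ i ∈ s, (f i).coeff w := by
  classical
  induction s using Finset.induction_on with
  | empty => simp
  | insert a s ha ih => simp [Finset.sum_insert ha, ih]

/-- A sequence of series is locally finite if each monomial occurs in finitely many of them. -/
def LocallyFinite (f : ℕ → NCSeries d) : Prop :=
  ∀ w, {n | (f n).coeff w ≠ 0}.Finite

/-- The formal sum `∑ₙ fₙ` of a locally finite sequence of series, coefficient by coefficient. -/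
noncomputable def formalSum (f : ℕ → NCSeries d) : NCSeries d :=
  ofCoeff fun w => ∑ᶠ n, (f n).coeff w

/-- The terms `((-1)ⁿ⁻¹ / n) (x / λ₀ - 1)ⁿ`, `n ≥ 1`, of the logarithm of a series `x` with constant
term `λ₀`, indexed from `0`. -/
noncomputable def logTerm (x : NCSeries d) (n : ℕ) : NCSeries d :=
  ((-1 : ℝ) ^ n / ((n : ℝ) + 1)) • ((x.coeff [])⁻¹ • x - 1) ^ (n + 1)

/-- The formal logarithm `log λ₀ + ∑_{n ≥ 1} ((-1)ⁿ⁻¹ / n) (x / λ₀ - 1)ⁿ` of a series `x` with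
constant term `λ₀ > 0`. -/
noncomputable def log (x : NCSeries d) : NCSeries d :=
  Real.log (x.coeff []) • (1 : NCSeries d) + formalSum (logTerm x)

/-- The `n`-th power of a series without constant term has no monomials of length `< n`. -/
theorem coeff_pow_eq_zero {u : NCSeries d} (hu : u.coeff [] = 0) (n : ℕ) (w : List (Fin d))
    (hw : w.length < n) : (u ^ n).coeff w = 0 := by
  induction n generalizing w with
  | zero => omega
  | succ n ih =>
    rw [pow_succ', coeff_mul]
    refine Finset.sum_eq_zero fun k hk => ?_
    rcases Nat.eq_zero_or_pos k with rfl | hk0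
    · simp [hu]
    · rw [ih _ (by rw [List.length_drop]; simp at hk; omega), mul_zero]

/-- The sum that defines the logarithm is locally finite. -/
theorem locallyFinite_logTerm {x : NCSeries d} (hx : 0 < x.coeff []) :
    LocallyFinite (logTerm x) := by
  intro w
  refine (Set.finite_lt_nat w.length).subset fun n hn => ?_
  by_contra h
  refine hn ?_
  rw [logTerm, coeff_smul, coeff_pow_eq_zero _ _ _ (by simp at h; omega), mul_zero]
  simp [coeff_one, hx.ne']

/-- The right-nested bracket `[e_{i₁}, [e_{i₂}, …, [e_{i_{k-1}}, e_{i_k}] … ]]` of the word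
`[i₁, …, i_k]`, where `⁅x, y⁆ = x * y - y * x`. For `k = 1` it is `e_{i₁}`; the value at the empty
word is never used. -/
noncomputable def nestedBracket : List (Fin d) → NCSeries d
  | [] => 0
  | [i] => e i
  | i :: j :: v => ⁅e i, nestedBracket (j :: v)⁆

/-- The Lie polynomial `∑_{i₁, …, i_k} λ_{i₁,…,i_k} [e_{i₁}, [e_{i₂}, …, [e_{i_{k-1}}, e_{i_k}] …]]`
of degree `k`. -/
noncomputable def liePolynomial (c : List (Fin d) → ℝ) (k : ℕ) : NCSeries d :=
  ∑ i : Fin k → Fin d, c (List.ofFn i) • nestedBracket (List.ofFn i)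

/-- The series
`∑_{k ≥ 1} ∑_{i₁, …, i_k} λ_{i₁,…,i_k} [e_{i₁}, [e_{i₂}, …, [e_{i_{k-1}}, e_{i_k}] … ]]`. -/
noncomputable def lieSeries (c : List (Fin d) → ℝ) : NCSeries d :=
  formalSum fun n => liePolynomial c (n + 1)

/-- A nested bracket of `k` indeterminates is homogeneous of degree `k`. -/
theorem coeff_nestedBracket_eq_zero (v w : List (Fin d)) (h : w.length ≠ v.length) :
    (nestedBracket v).coeff w = 0 := by
  induction v generalizing w with
  | nil => rfl
  | cons i v ih =>
    cases v with
    | nil =>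
      have : w ≠ [i] := by rintro rfl; simp at h
      simp [nestedBracket, e, monomial, this]
    | cons j v =>
      rw [nestedBracket, Ring.lie_def, coeff_sub, coeff_mul, coeff_mul]
      have key : ∀ p q : List (Fin d), p.length + q.length = w.length →
          (e i).coeff p * (nestedBracket (j :: v)).coeff q = 0 := by
        intro p q hpq
        by_cases hp : p = [i]
        · subst hp
          rw [ih q (by simp at h hpq ⊢; omega), mul_zero]
        · simp [e, monomial, hp]
      rw [Finset.sum_eq_zero, Finset.sum_eq_zero, sub_zero]
      · intro k hk
        rw [mul_comm]
        exact key _ _ (by simp at hk ⊢; omega)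
      · intro k hk
        exact key _ _ (by simp at hk ⊢; omega)

/-- The sum that defines `lieSeries` is locally finite. -/
theorem locallyFinite_liePolynomial (c : List (Fin d) → ℝ) :
    LocallyFinite fun n => liePolynomial c (n + 1) := by
  intro w
  refine (Set.finite_le_nat w.length).subset fun n hn => ?_
  by_contra h
  refine hn ?_
  simp only [liePolynomial, coeff_sum, coeff_smul]
  refine Finset.sum_eq_zero fun i _ => ?_
  rw [coeff_nestedBracket_eq_zero _ _ (by simp at h ⊢; omega), mul_zero]

end NCSeries

/-! ### Riemann–Stieltjes integrals and the signature -/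

/-- `I` is the Riemann–Stieltjes integral `∫_a^b Y dX`: the sums `∑ Y(cᵢ) (X(pᵢ₊₁) - X(pᵢ))` over
the partitions `a = p₀ ≤ p₁ ≤ … ≤ pₙ = b` with tags `cᵢ ∈ [pᵢ, pᵢ₊₁]` tend to `I` as the mesh tends
to `0`. -/
def IsRiemannStieltjesIntegral (Y X : ℝ → ℝ) (a b I : ℝ) : Prop :=
  ∀ ε > 0, ∃ δ > 0, ∀ (n : ℕ) (p c : ℕ → ℝ), p 0 = a → p n = b →
    (∀ i < n, p i ≤ c i ∧ c i ≤ p (i + 1) ∧ p (i + 1) - p i < δ) →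
    |∑ i ∈ Finset.range n, Y (c i) * (X (p (i + 1)) - X (p i)) - I| < ε

/-- The value of a Riemann–Stieltjes integral over `[a, b]` with `a ≤ b` is unique. -/
theorem IsRiemannStieltjesIntegral.unique {Y X : ℝ → ℝ} {a b I J : ℝ} (hab : a ≤ b)
    (hI : IsRiemannStieltjesIntegral Y X a b I) (hJ : IsRiemannStieltjesIntegral Y X a b J) :
    I = J := by
  by_contra hne
  have hpos : 0 < |I - J| / 2 := by
    have := abs_pos.mpr (sub_ne_zero.mpr hne)
    positivity
  obtain ⟨δ₁, h₁, H₁⟩ := hI _ hpos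
  obtain ⟨δ₂, h₂, H₂⟩ := hJ _ hpos
  obtain ⟨n, hn⟩ := exists_nat_gt ((b - a) / min δ₁ δ₂)
  have hδ : 0 < min δ₁ δ₂ := lt_min h₁ h₂
  have hn0 : (0 : ℝ) < n := lt_of_le_of_lt (div_nonneg (sub_nonneg.mpr hab) hδ.le) hn
  have hmesh : (b - a) / n < min δ₁ δ₂ := by
    rw [div_lt_iff₀ hδ] at hn
    rw [div_lt_iff₀ hn0]
    linarith
  have hstep : 0 ≤ (b - a) / n := div_nonneg (sub_nonneg.mpr hab) hn0.le
  let p : ℕ → ℝ := fun i => a + i * ((b - a) / n)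
  have hp0 : p 0 = a := by simp [p]
  have hpn : p n = b := by
    simp only [p]
    field_simp
    ring
  have hpi : ∀ i, p (i + 1) - p i = (b - a) / n := by
    intro i
    simp only [p]
    push_cast
    ring
  have hm₁ := H₁ n p p hp0 hpn fun i _ =>
    ⟨le_rfl, by linarith [hpi i], by linarith [hpi i, min_le_left δ₁ δ₂]⟩
  have hm₂ := H₂ n p p hp0 hpn fun i _ =>
    ⟨le_rfl, by linarith [hpi i], by linarith [hpi i, min_le_right δ₁ δ₂]⟩
  rw [abs_sub_comm] at hm₁
  have := abs_sub_le I (∑ i ∈ Finset.range n, Y (p i) * (X (p (i + 1)) - X (p i))) J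
  linarith

open scoped Classical in
/-- The Riemann–Stieltjes integral `∫_a^b Y dX` (and `0` if it does not exist). -/
noncomputable def riemannStieltjesIntegral (Y X : ℝ → ℝ) (a b : ℝ) : ℝ :=
  if h : ∃ I, IsRiemannStieltjesIntegral Y X a b I then h.choose else 0

/-- Auxiliary recursion for the iterated integrals, on the word read from its last letter. -/
noncomputable def iteratedIntegralRev {d : ℕ} (X : ℝ → EuclideanSpace ℝ (Fin d)) (a : ℝ) :
    List (Fin d) → ℝ → ℝ
  | [] => fun _ => 1
  | i :: w => fun t => riemannStieltjesIntegral (iteratedIntegralRev X a w) (fun s => X s i) a t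

/-- The iterated integral `S(X)^{i₁,…,i_k}_{a,t}` along the word `[i₁, …, i_k]`: it is `1` for the
empty word, and `S(X)^{i₁,…,i_k}_{a,t} = ∫_a^t S(X)^{i₁,…,i_{k-1}}_{a,s} dX^{i_k}_s`. -/
noncomputable def iteratedIntegral {d : ℕ} (X : ℝ → EuclideanSpace ℝ (Fin d)) (a : ℝ)
    (w : List (Fin d)) (t : ℝ) : ℝ :=
  iteratedIntegralRev X a w.reverse t

theorem iteratedIntegral_nil {d : ℕ} (X : ℝ → EuclideanSpace ℝ (Fin d)) (a t : ℝ) :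
    iteratedIntegral X a [] t = 1 := rfl

theorem iteratedIntegral_append_singleton {d : ℕ} (X : ℝ → EuclideanSpace ℝ (Fin d)) (a t : ℝ)
    (w : List (Fin d)) (i : Fin d) :
    iteratedIntegral X a (w ++ [i]) t =
      riemannStieltjesIntegral (iteratedIntegral X a w) (fun s => X s i) a t := by
  simp only [iteratedIntegral, List.reverse_append, List.reverse_singleton, List.singleton_append]
  rfl

/-- The signature `S(X)_{a,b}`, as the formal power series whose coefficient at
`e_{i₁} … e_{i_k}` is `S(X)^{i₁,…,i_k}_{a,b}`. -/
noncomputable def signature {d : ℕ} (X : ℝ → EuclideanSpace ℝ (Fin d)) (a b : ℝ) : NCSeries d :=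
  NCSeries.ofCoeff fun w => iteratedIntegral X a w b

/-! The signature $S_t$ solves the linear equation $dS=S\,dX$, $S_a=1$, where $dX=\sum_j e_j\,dX^j$.
Let $E$ multiply words of length $k$ by $k$, let $D$ send a word to its right-nested bracket, and
let `adjoint` be the action of series in which $e_i$ acts as $[e_i,\cdot]$. Then $D(x e_j)$ is the
action of $x$ on $e_j$.

For a solution $S$, two identities follow by showing that the difference of the two sides starts at
zero and has zero differential, degree by degree: `adjoint S y * S = S * y` (the action of $S$ is
conjugation), and then $D(S)S=E(S)$. Both pass to products, hence to all powers $S^N$.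

Each coefficient of $S^N=\sum_n\binom Nn (S-1)^n$ is a polynomial in $N$ with linear term that of
$\log S$. Comparing the terms linear in $N$ in $D(S^N)S^N=E(S^N)$, where $D(1)=0$, gives $D(\log
S)=E(\log S)$. So the degree-$k$ part of $\log S$ is $1/k$ times its image under $D$, a combination
of brackets (Dynkin–Specht–Wever). Neither shuffle relations nor a coproduct are needed.

The analysis dominates increments of $X$ by those of a Stieltjes function $V$. A function is
differentiated by knowing its increments up to $o(V(t)-V(s))$ uniformly; this supports a product
rule and the fact that a zero differential forces a constant. -/

open MeasureTheory Set

/-! ### Riemann–Stieltjes integrals against dominated functions -/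

/-- A continuous path of bounded variation is dominated by a monotone right-continuous function. -/
theorem exists_stieltjesFunction_dominating {E : Type*} [NormedAddCommGroup E] {a b : ℝ}
    (hab : a ≤ b) {X : ℝ → E} (hX : ContinuousOn X (Icc a b))
    (hXbv : BoundedVariationOn X (Icc a b)) :
    ∃ (X' : ℝ → E) (V : StieltjesFunction ℝ), Continuous X' ∧ EqOn X' X (Icc a b) ∧
      ∀ s t, s ≤ t → ‖X' t - X' s‖ ≤ V t - V s := by
  -- The path is extended by its endpoint values, so that it is continuous with bounded variation on
  -- the whole line.
  set X' : ℝ → E := fun t => X (projIcc a b hab t) with hX'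
  have hc : Continuous X' :=
    (continuousOn_iff_continuous_domRestrict.mp hX).comp continuous_projIcc
  have hbv : BoundedVariationOn X' univ := by
    refine ne_top_of_le_ne_top hXbv
      (eVariationOn.comp_le_of_monotoneOn X (fun t => (projIcc a b hab t : ℝ)) ?_ ?_)
    · exact fun s _ t _ hst => monotone_projIcc hab hst
    · exact fun t _ => (projIcc a b hab t).2
  have hloc : LocallyBoundedVariationOn X' univ := hbv.locallyBoundedVariationOn
  refine ⟨X', ⟨variationOnFromTo X' univ a, ?_, ?_⟩, hc, ?_, ?_⟩
  · exact fun s t hst => variationOnFromTo.monotoneOn hloc (mem_univ a) (mem_univ s) (mem_univ t) hst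
  · exact fun x => hbv.continuousWithinAt_variationOnFromTo_Ici hc.continuousWithinAt
  · intro t ht
    simp [hX', projIcc_of_mem hab ht]
  · intro s t hst
    change ‖X' t - X' s‖ ≤ variationOnFromTo X' univ a t - variationOnFromTo X' univ a s
    rw [← variationOnFromTo.add hloc (mem_univ a) (mem_univ s) (mem_univ t), add_sub_cancel_left,
      variationOnFromTo.eq_of_le _ _ hst, ← dist_eq_norm]
    exact (hloc s t (mem_univ s) (mem_univ t)).dist_le ⟨mem_univ _, hst, le_rfl⟩
      ⟨mem_univ _, le_rfl, hst⟩

/-- The difference is the integral of $Y-Y(s)$ over $(s,t]$, a set of mass $V(t)-V(s)$. -/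
theorem StieltjesFunction.abs_integral_sub_le (V : StieltjesFunction ℝ) {Y : ℝ → ℝ}
    (hY : Continuous Y) {s t ε : ℝ} (hst : s ≤ t) (h : ∀ u ∈ Ioc s t, |Y u - Y s| ≤ ε) :
    |(∫ u in s..t, Y u ∂V.measure) - Y s * (V t - V s)| ≤ ε * (V t - V s) := by
  have hV : V.measure.real (Ioc s t) = V t - V s := by
    rw [Measure.real, V.measure_Ioc, ENNReal.toReal_ofReal (sub_nonneg.mpr (V.mono hst))]
  have h1 : (∫ u in s..t, Y u ∂V.measure) - Y s * (V t - V s) =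
      ∫ u in Ioc s t, (Y u - Y s) ∂V.measure := by
    rw [intervalIntegral.integral_of_le hst, integral_sub, setIntegral_const, hV, smul_eq_mul,
      mul_comm]
    · exact (hY.integrableOn_Icc).mono_set Ioc_subset_Icc_self
    · exact (continuous_const.integrableOn_Icc).mono_set Ioc_subset_Icc_self
  rw [h1, ← hV, ← Real.norm_eq_abs]
  refine norm_setIntegral_le_of_norm_le_const
    (by rw [V.measure_Ioc]; exact ENNReal.ofReal_lt_top) fun u hu => ?_
  rw [Real.norm_eq_abs]
  exact h u hu

theorem uniformContinuousOn_Icc_dist {Y : ℝ → ℝ} {a b : ℝ} (hY : ContinuousOn Y (Icc a b))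
    {ε : ℝ} (hε : 0 < ε) : ∃ δ > 0, ∀ s ∈ Icc a b, ∀ t ∈ Icc a b, |t - s| < δ →
      |Y t - Y s| < ε := by
  obtain ⟨δ, hδ, H⟩ := Metric.uniformContinuousOn_iff.mp
    (isCompact_Icc.uniformContinuousOn_of_continuous hY) ε hε
  exact ⟨δ, hδ, fun s hs t ht hst => H t ht s hs hst⟩

/-- The indefinite Stieltjes integral of a continuous function against a continuous function
dominated by `V`. -/
theorem exists_primitive_of_dominated {a : ℝ} {x Y : ℝ → ℝ} (hx : Continuous x)
    (hY : Continuous Y) (V : StieltjesFunction ℝ) (hV : ∀ s t, s ≤ t → |x t - x s| ≤ V t - V s) :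
    ∃ g : ℝ → ℝ, g a = 0 ∧ ∀ ε s t, s ≤ t → (∀ u ∈ Ioc s t, |Y u - Y s| ≤ ε) →
      |g t - g s - Y s * (x t - x s)| ≤ 3 * ε * (V t - V s) := by
  -- Jordan-type decomposition $x=V-Q$: domination makes $Q$ monotone, continuity of $x$ makes it
  -- right-continuous. The integral against $x$ is a difference of two Lebesgue–Stieltjes integrals.
  let Q : StieltjesFunction ℝ :=
    ⟨fun t => V t - x t, fun s t hst => by
      have := (abs_le.mp (hV s t hst)).2
      change V s - x s ≤ V t - x t
      linarith,
     fun t => (V.right_continuous t).sub hx.continuousWithinAt⟩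
  have hQ : ∀ t, Q t = V t - x t := fun t => rfl
  refine ⟨fun t => (∫ u in a..t, Y u ∂V.measure) - ∫ u in a..t, Y u ∂Q.measure, by simp, ?_⟩
  intro ε s t hst hosc
  have hi : ∀ (W : StieltjesFunction ℝ) (p q : ℝ), IntervalIntegrable Y W.measure p q :=
    fun W p q => hY.intervalIntegrable p q
  have h1 := V.abs_integral_sub_le hY hst hosc
  have h2 := Q.abs_integral_sub_le hY hst hosc
  have e1 := intervalIntegral.integral_add_adjacent_intervals (hi V a s) (hi V s t)
  have e2 := intervalIntegral.integral_add_adjacent_intervals (hi Q a s) (hi Q s t)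
  -- Increments of $Q$ are at most twice those of $V$, whence $1+2=3$ in the bound. For $s=t$ the
  -- oscillation hypothesis is vacuous and $ε$ may be negative, but both sides vanish.
  have h4 : ε * (Q t - Q s) ≤ ε * (2 * (V t - V s)) := by
    rcases hst.eq_or_lt with rfl | hlt
    · simp
    · have hε : 0 ≤ ε := (abs_nonneg _).trans (hosc t ⟨hlt, le_rfl⟩)
      have := (abs_le.mp (hV s t hst)).1
      refine mul_le_mul_of_nonneg_left ?_ hε
      rw [hQ, hQ]
      linarith
  have e3 : Y s * (Q t - Q s) = Y s * (V t - V s) - Y s * (x t - x s) := by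
    rw [hQ, hQ]; ring
  rw [abs_le] at h1 h2 ⊢
  constructor <;> simp only [← e1, ← e2] <;> linarith [h1.1, h1.2, h2.1, h2.2]

/-- A function with local increments `Y(s) (x(t) - x(s))` up to `o(V(t) - V(s))` is the indefinite
Riemann–Stieltjes integral of `Y` against `x`. -/
theorem isRiemannStieltjesIntegral_of_increments {a b : ℝ} {x Y f V : ℝ → ℝ}
    (hY : ContinuousOn Y (Icc a b)) (hV : ∀ s t, a ≤ s → s ≤ t → t ≤ b → |x t - x s| ≤ V t - V s)
    (hf : ∀ ε > 0, ∃ δ > 0, ∀ s t, a ≤ s → s ≤ t → t ≤ b → t - s < δ →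
      |f t - f s - Y s * (x t - x s)| ≤ ε * (V t - V s)) {t : ℝ} (ht : t ∈ Icc a b) :
    IsRiemannStieltjesIntegral Y x a t (f t - f a) := by
  intro ε hε
  have hVt : 0 ≤ V t - V a := (abs_nonneg _).trans (hV a t le_rfl ht.1 ht.2)
  -- Each cell costs $η$ for moving the tag to the left endpoint and $η$ for the increment of $f$;
  -- the $+1$ keeps the denominator positive.
  set η : ℝ := ε / (2 * (V t - V a) + 1) with hη
  have hη0 : 0 < η := by positivity
  obtain ⟨δ₁, hδ₁, H₁⟩ := hf η hη0
  obtain ⟨δ₂, hδ₂, H₂⟩ := uniformContinuousOn_Icc_dist hY hη0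
  refine ⟨min δ₁ δ₂, lt_min hδ₁ hδ₂, fun n p c hp0 hpn hp => ?_⟩
  have hle : ∀ i < n, p i ≤ p (i + 1) := fun i hi => (hp i hi).1.trans (hp i hi).2.1
  have hlow : ∀ i ≤ n, a ≤ p i := by
    intro i
    induction i with
    | zero => intro _; exact hp0.ge
    | succ i ih => intro hi; exact (ih (by omega)).trans (hle i (by omega))
  have hup : ∀ k ≤ n, p (n - k) ≤ t := by
    intro k
    induction k with
    | zero => intro _; exact hpn.le
    | succ k ih =>
      intro hk
      refine le_trans ?_ (ih (by omega))
      have := hle (n - (k + 1)) (by omega)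
      rwa [show n - (k + 1) + 1 = n - k by omega] at this
  have hup' : ∀ i ≤ n, p i ≤ b := fun i hi => by
    have := hup (n - i) (by omega)
    rw [show n - (n - i) = i by omega] at this
    exact this.trans ht.2
  have e1 : f t - f a = ∑ i ∈ Finset.range n, (f (p (i + 1)) - f (p i)) := by
    rw [Finset.sum_range_sub (fun i => f (p i)), hp0, hpn]
  have e2 : V t - V a = ∑ i ∈ Finset.range n, (V (p (i + 1)) - V (p i)) := by
    rw [Finset.sum_range_sub (fun i => V (p i)), hp0, hpn]
  rw [e1, ← Finset.sum_sub_distrib]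
  calc _ ≤ ∑ i ∈ Finset.range n, |Y (c i) * (x (p (i + 1)) - x (p i)) - (f (p (i + 1)) - f (p i))| :=
        Finset.abs_sum_le_sum_abs _ _
    _ ≤ ∑ i ∈ Finset.range n, 2 * η * (V (p (i + 1)) - V (p i)) := by
        refine Finset.sum_le_sum fun i hi => ?_
        have hi' := Finset.mem_range.mp hi
        obtain ⟨hc1, hc2, hm⟩ := hp i hi'
        have k1 := hlow i hi'.le
        have k2 := hup' (i + 1) hi'
        have h1 := H₁ (p i) (p (i + 1)) k1 (hle i hi') k2
          (hm.trans_le (min_le_left _ _))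
        have h2 := (H₂ (p i) ⟨k1, (hle i hi').trans k2⟩ (c i) ⟨k1.trans hc1, hc2.trans k2⟩ (by
          rw [abs_of_nonneg (sub_nonneg.mpr hc1)]
          linarith [min_le_right δ₁ δ₂])).le
        have h3 := hV (p i) (p (i + 1)) k1 (hle i hi') k2
        have h4 : |(Y (c i) - Y (p i)) * (x (p (i + 1)) - x (p i))| ≤
            η * (V (p (i + 1)) - V (p i)) := by
          rw [abs_mul]
          exact mul_le_mul h2 h3 (abs_nonneg _) hη0.le
        rw [abs_le] at h1 h4 ⊢
        constructor <;> linarith [h1.1, h1.2, h4.1, h4.2]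
    _ = 2 * η * (V t - V a) := by rw [← Finset.mul_sum, ← e2]
    _ < ε := by
        rw [hη, mul_div_assoc', div_mul_eq_mul_div, div_lt_iff₀ (by positivity)]
        nlinarith

/-! ### Calculus of Stieltjes differentials -/

/-- `f` is an indefinite integral `∑ⱼ ∫ Yⱼ dXʲ` on `[a, b]`: it is continuous, its increments are
dominated by those of `V`, and they agree with `∑ⱼ Yⱼ(s) (Xʲ(t) - Xʲ(s))` up to
`o(V(t) - V(s))`. -/
structure HasStieltjesDifferential {d : ℕ} (X : ℝ → EuclideanSpace ℝ (Fin d)) (V : ℝ → ℝ)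
    (a b : ℝ) (f : ℝ → ℝ) (Y : Fin d → ℝ → ℝ) : Prop where
  continuousOn : ContinuousOn f (Icc a b)
  dominated : ∃ C, 0 ≤ C ∧ ∀ s t, a ≤ s → s ≤ t → t ≤ b → |f t - f s| ≤ C * (V t - V s)
  increments : ∀ ε > 0, ∃ δ > 0, ∀ s t, a ≤ s → s ≤ t → t ≤ b → t - s < δ →
    |f t - f s - ∑ j, Y j s * (X t j - X s j)| ≤ ε * (V t - V s)

namespace HasStieltjesDifferential

variable {d : ℕ} {X : ℝ → EuclideanSpace ℝ (Fin d)} {V : ℝ → ℝ} {a b : ℝ} {f g : ℝ → ℝ}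
  {Y Z : Fin d → ℝ → ℝ}

theorem congr (hf : HasStieltjesDifferential X V a b f Y) (hfg : EqOn g f (Icc a b))
    (hYZ : ∀ j, EqOn (Z j) (Y j) (Icc a b)) : HasStieltjesDifferential X V a b g Z := by
  refine ⟨hf.continuousOn.congr hfg, ?_, fun ε hε => ?_⟩
  · obtain ⟨C, hC, H⟩ := hf.dominated
    refine ⟨C, hC, fun s t has hst htb => ?_⟩
    rw [hfg ⟨has.trans hst, htb⟩, hfg ⟨has, hst.trans htb⟩]
    exact H s t has hst htb
  · obtain ⟨δ, hδ, H⟩ := hf.increments ε hε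
    refine ⟨δ, hδ, fun s t has hst htb h => ?_⟩
    rw [hfg ⟨has.trans hst, htb⟩, hfg ⟨has, hst.trans htb⟩]
    simp only [fun j => hYZ j ⟨has, hst.trans htb⟩]
    exact H s t has hst htb h

theorem const (hV : MonotoneOn V (Icc a b)) (r : ℝ) :
    HasStieltjesDifferential X V a b (fun _ => r) (fun _ _ => 0) := by
  have h : ∀ s t, a ≤ s → s ≤ t → t ≤ b → 0 ≤ V t - V s := fun s t has hst htb =>
    sub_nonneg.mpr (hV ⟨has, hst.trans htb⟩ ⟨has.trans hst, htb⟩ hst)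
  refine ⟨continuousOn_const, ⟨0, le_rfl, by simp⟩, fun ε hε =>
    ⟨1, one_pos, fun s t has hst htb _ => ?_⟩⟩
  simpa using mul_nonneg hε.le (h s t has hst htb)

theorem add (hf : HasStieltjesDifferential X V a b f Y)
    (hg : HasStieltjesDifferential X V a b g Z) :
    HasStieltjesDifferential X V a b (fun t => f t + g t) (fun j t => Y j t + Z j t) := by
  refine ⟨hf.continuousOn.add hg.continuousOn, ?_, fun ε hε => ?_⟩
  · obtain ⟨C, hC, H⟩ := hf.dominated
    obtain ⟨C', hC', H'⟩ := hg.dominated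
    refine ⟨C + C', add_nonneg hC hC', fun s t has hst htb => ?_⟩
    have h1 := H s t has hst htb
    have h2 := H' s t has hst htb
    rw [abs_le] at h1 h2 ⊢
    constructor <;> linarith [h1.1, h1.2, h2.1, h2.2]
  · obtain ⟨δ, hδ, H⟩ := hf.increments (ε / 2) (half_pos hε)
    obtain ⟨δ', hδ', H'⟩ := hg.increments (ε / 2) (half_pos hε)
    refine ⟨min δ δ', lt_min hδ hδ', fun s t has hst htb h => ?_⟩
    have h1 := H s t has hst htb (h.trans_le (min_le_left _ _))
    have h2 := H' s t has hst htb (h.trans_le (min_le_right _ _))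
    simp only [add_mul, Finset.sum_add_distrib]
    rw [abs_le] at h1 h2 ⊢
    constructor <;> linarith [h1.1, h1.2, h2.1, h2.2]

theorem exists_abs_le (hf : HasStieltjesDifferential X V a b f Y) :
    ∃ M, 0 < M ∧ ∀ t ∈ Icc a b, |f t| ≤ M := by
  obtain ⟨M, hM⟩ := isCompact_Icc.exists_bound_of_continuousOn hf.continuousOn
  exact ⟨max M 1, by positivity, fun t ht => (hM t ht).trans (le_max_left _ _)⟩

/-- Integration by parts. -/
theorem mul (hV : MonotoneOn V (Icc a b)) (hf : HasStieltjesDifferential X V a b f Y)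
    (hg : HasStieltjesDifferential X V a b g Z) :
    HasStieltjesDifferential X V a b (fun t => f t * g t)
      (fun j t => Y j t * g t + f t * Z j t) := by
  obtain ⟨M, hM, hfM⟩ := hf.exists_abs_le
  obtain ⟨N, hN, hgN⟩ := hg.exists_abs_le
  obtain ⟨C, hC, HC⟩ := hf.dominated
  obtain ⟨C', hC', HC'⟩ := hg.dominated
  have hVn : ∀ s t, a ≤ s → s ≤ t → t ≤ b → 0 ≤ V t - V s := fun s t has hst htb =>
    sub_nonneg.mpr (hV ⟨has, hst.trans htb⟩ ⟨has.trans hst, htb⟩ hst)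
  refine ⟨hf.continuousOn.mul hg.continuousOn, ⟨M * C' + N * C, by positivity, ?_⟩,
    fun ε hε => ?_⟩
  · intro s t has hst htb
    have h1 : |f t * (g t - g s)| ≤ M * (C' * (V t - V s)) := by
      rw [abs_mul]
      exact mul_le_mul (hfM t ⟨has.trans hst, htb⟩) (HC' s t has hst htb) (abs_nonneg _) hM.le
    have h2 : |g s * (f t - f s)| ≤ N * (C * (V t - V s)) := by
      rw [abs_mul]
      exact mul_le_mul (hgN s ⟨has, hst.trans htb⟩) (HC s t has hst htb) (abs_nonneg _) hN.le
    rw [abs_le] at h1 h2 ⊢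
    constructor <;> linarith [h1.1, h1.2, h2.1, h2.2]
  · obtain ⟨δ₁, hδ₁, H₁⟩ := hf.increments (ε / (3 * N)) (by positivity)
    obtain ⟨δ₂, hδ₂, H₂⟩ := hg.increments (ε / (3 * M)) (by positivity)
    -- $C+1$ rather than $C$, since $C$ may be zero.
    obtain ⟨δ₃, hδ₃, H₃⟩ := uniformContinuousOn_Icc_dist hg.continuousOn
      (show 0 < ε / (3 * (C + 1)) by positivity)
    refine ⟨min δ₁ (min δ₂ δ₃), by positivity, fun s t has hst htb h => ?_⟩
    have hs : s ∈ Icc a b := ⟨has, hst.trans htb⟩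
    have ht : t ∈ Icc a b := ⟨has.trans hst, htb⟩
    have hv := hVn s t has hst htb
    have h1 : |g s * (f t - f s - ∑ j, Y j s * (X t j - X s j))| ≤ ε / 3 * (V t - V s) := by
      rw [abs_mul]
      refine (mul_le_mul (hgN s hs) (H₁ s t has hst htb (h.trans_le (min_le_left _ _)))
        (abs_nonneg _) hN.le).trans_eq ?_
      field_simp
    have h2 : |f s * (g t - g s - ∑ j, Z j s * (X t j - X s j))| ≤ ε / 3 * (V t - V s) := by
      rw [abs_mul]
      refine (mul_le_mul (hfM s hs) (H₂ s t has hst htb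
        (h.trans_le ((min_le_right _ _).trans (min_le_left _ _))))
        (abs_nonneg _) hM.le).trans_eq ?_
      field_simp
    have h3 : |(g t - g s) * (f t - f s)| ≤ ε / 3 * (V t - V s) := by
      rw [abs_mul]
      refine (mul_le_mul (H₃ s hs t ht ?_).le (HC s t has hst htb) (abs_nonneg _)
        (by positivity)).trans ?_
      · rw [abs_of_nonneg (sub_nonneg.mpr hst)]
        exact h.trans_le ((min_le_right _ _).trans (min_le_right _ _))
      · rw [← mul_assoc]
        refine mul_le_mul_of_nonneg_right ?_ hv
        rw [div_mul_eq_mul_div, div_le_div_iff₀ (by positivity) (by positivity)]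
        nlinarith
    -- Discrete product rule; the second-order term is negligible because $g$ is uniformly
    -- continuous and increments of $f$ are $O(V(t)-V(s))$.
    have key : f t * g t - f s * g s - ∑ j, (Y j s * g s + f s * Z j s) * (X t j - X s j) =
        g s * (f t - f s - ∑ j, Y j s * (X t j - X s j)) +
        f s * (g t - g s - ∑ j, Z j s * (X t j - X s j)) + (g t - g s) * (f t - f s) := by
      have : ∑ j, (Y j s * g s + f s * Z j s) * (X t j - X s j) =
          g s * ∑ j, Y j s * (X t j - X s j) + f s * ∑ j, Z j s * (X t j - X s j) := by
        rw [Finset.mul_sum, Finset.mul_sum, ← Finset.sum_add_distrib]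
        exact Finset.sum_congr rfl fun j _ => by ring
      rw [this]
      ring
    rw [key]
    rw [abs_le] at h1 h2 h3 ⊢
    constructor <;> linarith [h1.1, h1.2, h2.1, h2.2, h3.1, h3.2]

theorem const_mul (hV : MonotoneOn V (Icc a b)) (hf : HasStieltjesDifferential X V a b f Y)
    (r : ℝ) : HasStieltjesDifferential X V a b (fun t => r * f t) (fun j t => r * Y j t) :=
  ((const hV r).mul hV hf).congr (fun _ _ => rfl) fun j t _ => by simp

theorem sum (hV : MonotoneOn V (Icc a b)) {ι : Type*} (s : Finset ι) {F : ι → ℝ → ℝ}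
    {G : ι → Fin d → ℝ → ℝ} (h : ∀ i ∈ s, HasStieltjesDifferential X V a b (F i) (G i)) :
    HasStieltjesDifferential X V a b (fun t => ∑ i ∈ s, F i t) (fun j t => ∑ i ∈ s, G i j t) := by
  classical
  induction s using Finset.induction_on with
  | empty => simpa using const hV 0
  | insert i s hi ih =>
    simp only [Finset.sum_insert hi]
    exact (h i (Finset.mem_insert_self i s)).add
      (ih fun k hk => h k (Finset.mem_insert_of_mem hk))

/-- A function with zero differential is constant. -/
theorem eq_of_zero (hV : MonotoneOn V (Icc a b)) (hf : HasStieltjesDifferential X V a b f Y)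
    (hY : ∀ j, ∀ t ∈ Icc a b, Y j t = 0) {t : ℝ} (ht : t ∈ Icc a b) : f t = f a := by
  -- The increments of $f$ are $o(V(t)-V(s))$, so $f(t)-f(a)$ is an integral of zero against zero;
  -- uniqueness of the integral finishes.
  have h1 : IsRiemannStieltjesIntegral (fun _ => 0) (fun _ => 0) a t (f t - f a) := by
    refine isRiemannStieltjesIntegral_of_increments (V := V) continuousOn_const ?_ ?_ ht
    · intro s t has hst htb
      simpa using hV ⟨has, hst.trans htb⟩ ⟨has.trans hst, htb⟩ hst
    · intro ε hε
      obtain ⟨δ, hδ, H⟩ := hf.increments ε hε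
      refine ⟨δ, hδ, fun s t has hst htb h => ?_⟩
      have := H s t has hst htb h
      simpa [hY _ s ⟨has, hst.trans htb⟩] using this
  have h2 : IsRiemannStieltjesIntegral (fun _ => 0) (fun _ => 0) a t 0 :=
    fun ε hε => ⟨1, one_pos, fun n p c _ _ _ => by simpa using hε⟩
  linarith [h1.unique ht.1 h2]

end HasStieltjesDifferential

/-! ### Existence of the iterated integrals -/

/-- Every continuous function has an indefinite Riemann–Stieltjes integral against a coordinate of
a path that is continuous and dominated by `V`. -/
theorem exists_hasStieltjesDifferential {d : ℕ} {X X' : ℝ → EuclideanSpace ℝ (Fin d)} {a b : ℝ}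
    (hab : a ≤ b) (V : StieltjesFunction ℝ) (hX' : Continuous X') (hXX' : EqOn X' X (Icc a b))
    (hV : ∀ s t, s ≤ t → ‖X' t - X' s‖ ≤ V t - V s) {Y : ℝ → ℝ}
    (hY : ContinuousOn Y (Icc a b)) (i : Fin d) :
    ∃ g, g a = 0 ∧ HasStieltjesDifferential X V a b g (fun j t => if j = i then Y t else 0) := by
  set Y' : ℝ → ℝ := fun t => Y (projIcc a b hab t) with hY'
  have hYc : Continuous Y' :=
    (continuousOn_iff_continuous_domRestrict.mp hY).comp continuous_projIcc
  have hYY' : EqOn Y' Y (Icc a b) := fun t ht => by simp [hY', projIcc_of_mem hab ht]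
  have hxc : Continuous fun t => X' t i := by fun_prop
  have hxV : ∀ s t, s ≤ t → |X' t i - X' s i| ≤ V t - V s := fun s t hst =>
    (PiLp.norm_apply_le (X' t - X' s) i).trans (hV s t hst)
  obtain ⟨g, hga, hg⟩ := exists_primitive_of_dominated (a := a) hxc hYc V hxV
  have hg' : ∀ ε s t, a ≤ s → s ≤ t → t ≤ b → (∀ u ∈ Ioc s t, |Y u - Y s| ≤ ε) →
      |g t - g s - Y s * (X t i - X s i)| ≤ 3 * ε * (V t - V s) := by
    intro ε s t has hst htb hosc
    have hs : s ∈ Icc a b := ⟨has, hst.trans htb⟩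
    have := hg ε s t hst fun u hu => by
      rw [hYY' ⟨has.trans hu.1.le, hu.2.trans htb⟩, hYY' hs]
      exact hosc u hu
    rwa [hYY' hs, hXX' hs, hXX' ⟨has.trans hst, htb⟩] at this
  have hinc : ∀ ε > 0, ∃ δ > 0, ∀ s t, a ≤ s → s ≤ t → t ≤ b → t - s < δ →
      |g t - g s - Y s * (X t i - X s i)| ≤ ε * (V t - V s) := by
    intro ε hε
    obtain ⟨δ, hδ, H⟩ := uniformContinuousOn_Icc_dist hY (show 0 < ε / 3 by positivity)
    refine ⟨δ, hδ, fun s t has hst htb h => ?_⟩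
    refine (hg' (ε / 3) s t has hst htb fun u hu => ?_).trans_eq (by ring)
    refine (H s ⟨has, hst.trans htb⟩ u ⟨has.trans hu.1.le, hu.2.trans htb⟩ ?_).le
    rw [abs_of_pos (sub_pos.mpr hu.1)]
    linarith [hu.2]
  obtain ⟨M, hM⟩ := isCompact_Icc.exists_bound_of_continuousOn hY
  have hM0 : 0 ≤ M := (norm_nonneg _).trans (hM a ⟨le_rfl, hab⟩)
  have hVm : ∀ s t, s ≤ t → 0 ≤ V t - V s := fun s t hst => sub_nonneg.mpr (V.mono hst)
  have hYs : ∀ s t, a ≤ s → s ≤ t → t ≤ b →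
      |Y s * (X t i - X s i)| ≤ M * |X' t i - X' s i| := by
    intro s t has hst htb
    have hs : s ∈ Icc a b := ⟨has, hst.trans htb⟩
    rw [hXX' hs, hXX' ⟨has.trans hst, htb⟩, abs_mul]
    exact mul_le_mul_of_nonneg_right (hM s hs) (abs_nonneg _)
  -- $Y$ oscillates by at most $2M$, which contributes $3\cdot 2M$; the main term $Y(s)(x(t)-x(s))$
  -- contributes $M$.
  refine ⟨g, hga, ?_, ⟨7 * M, by positivity, ?_⟩, ?_⟩
  · rw [Metric.continuousOn_iff]
    have hsymm : ∀ ε > 0, ∃ δ > 0, ∀ s t, a ≤ s → s ≤ t → t ≤ b → t - s < δ →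
        |g t - g s| < ε := by
      intro ε hε
      have hVab := hVm a b hab
      obtain ⟨δ₁, hδ₁, H₁⟩ := hinc (ε / (2 * (V b - V a) + 1)) (by positivity)
      obtain ⟨δ₂, hδ₂, H₂⟩ := uniformContinuousOn_Icc_dist (a := a) (b := b) hxc.continuousOn
        (show 0 < ε / (2 * M + 1) by positivity)
      refine ⟨min δ₁ δ₂, lt_min hδ₁ hδ₂, fun s t has hst htb h => ?_⟩
      have h1 := H₁ s t has hst htb (h.trans_le (min_le_left _ _))
      have h2 := (H₂ s ⟨has, hst.trans htb⟩ t ⟨has.trans hst, htb⟩ (by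
        rw [abs_of_nonneg (sub_nonneg.mpr hst)]
        exact h.trans_le (min_le_right _ _))).le
      have h3 := (hYs s t has hst htb).trans (mul_le_mul_of_nonneg_left h2 hM0)
      have h4 : ε / (2 * (V b - V a) + 1) * (V t - V s) < ε / 2 := by
        have : V t - V s ≤ V b - V a := by linarith [V.mono has, V.mono htb]
        rw [div_mul_eq_mul_div, div_lt_div_iff₀ (by positivity) two_pos]
        nlinarith
      have h5 : M * (ε / (2 * M + 1)) < ε / 2 := by
        rw [mul_div_assoc', div_lt_div_iff₀ (by positivity) two_pos]
        nlinarith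
      rw [abs_le] at h1 h3
      rw [abs_lt]
      constructor <;> linarith [h1.1, h1.2, h3.1, h3.2]
    intro t ht ε hε
    obtain ⟨δ, hδ, H⟩ := hsymm ε hε
    refine ⟨δ, hδ, fun s hs hst => ?_⟩
    rw [Real.dist_eq] at hst ⊢
    rcases le_total s t with h | h
    · rw [abs_sub_comm] at hst ⊢
      exact H s t hs.1 h ht.2 ((le_abs_self _).trans_lt hst)
    · exact H t s ht.1 h hs.2 ((le_abs_self _).trans_lt hst)
  · intro s t has hst htb
    have h1 := hg' (2 * M) s t has hst htb fun u hu => by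
      have h2 := hM u ⟨has.trans hu.1.le, hu.2.trans htb⟩
      have h3 := hM s ⟨has, hst.trans htb⟩
      rw [Real.norm_eq_abs] at h2 h3
      exact (abs_sub _ _).trans (by linarith)
    have h2 := (hYs s t has hst htb).trans (mul_le_mul_of_nonneg_left (hxV s t hst) hM0)
    rw [abs_le] at h1 h2 ⊢
    constructor <;> linarith [h1.1, h1.2, h2.1, h2.2]
  · simpa using hinc

/-- The iterated integrals of a continuous path of bounded variation exist. -/
theorem iteratedIntegral_spec {d : ℕ} {X X' : ℝ → EuclideanSpace ℝ (Fin d)} {a b : ℝ}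
    (hab : a ≤ b) (V : StieltjesFunction ℝ) (hX' : Continuous X') (hXX' : EqOn X' X (Icc a b))
    (hV : ∀ s t, s ≤ t → ‖X' t - X' s‖ ≤ V t - V s) (w : List (Fin d)) :
    ContinuousOn (iteratedIntegral X a w) (Icc a b) ∧ ∀ i,
      iteratedIntegral X a (w ++ [i]) a = 0 ∧
      HasStieltjesDifferential X V a b (iteratedIntegral X a (w ++ [i]))
        (fun j t => if j = i then iteratedIntegral X a w t else 0) ∧
      ∀ t ∈ Icc a b, IsRiemannStieltjesIntegral (iteratedIntegral X a w) (fun s => X s i) a t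
        (iteratedIntegral X a (w ++ [i]) t) := by
  have step : ∀ w, ContinuousOn (iteratedIntegral X a w) (Icc a b) → ∀ i,
      iteratedIntegral X a (w ++ [i]) a = 0 ∧
      HasStieltjesDifferential X V a b (iteratedIntegral X a (w ++ [i]))
        (fun j t => if j = i then iteratedIntegral X a w t else 0) ∧
      ∀ t ∈ Icc a b, IsRiemannStieltjesIntegral (iteratedIntegral X a w) (fun s => X s i) a t
        (iteratedIntegral X a (w ++ [i]) t) := by
    intro w hw i
    obtain ⟨g, hga, hg⟩ := exists_hasStieltjesDifferential hab V hX' hXX' hV hw i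
    have hRS : ∀ t ∈ Icc a b, IsRiemannStieltjesIntegral (iteratedIntegral X a w)
        (fun s => X s i) a t (g t) := by
      intro t ht
      have := isRiemannStieltjesIntegral_of_increments (V := V) (x := fun s => X s i) (f := g) hw
        (fun s t has hst htb => by
          rw [← hXX' ⟨has, hst.trans htb⟩, ← hXX' ⟨has.trans hst, htb⟩]
          exact (PiLp.norm_apply_le (X' t - X' s) i).trans (hV s t hst))
        (by simpa using hg.increments) ht
      rwa [hga, sub_zero] at this
    have hEq : EqOn (iteratedIntegral X a (w ++ [i])) g (Icc a b) := by
      intro t ht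
      -- The integral is defined by choice, so uniqueness is what identifies it with $g$.
      have hex : ∃ I, IsRiemannStieltjesIntegral (iteratedIntegral X a w) (fun s => X s i) a t I :=
        ⟨g t, hRS t ht⟩
      rw [iteratedIntegral_append_singleton, riemannStieltjesIntegral, dif_pos hex]
      exact hex.choose_spec.unique ht.1 (hRS t ht)
    refine ⟨?_, hg.congr hEq fun _ _ _ => rfl, fun t ht => ?_⟩
    · rw [hEq ⟨le_rfl, hab⟩, hga]
    · rw [hEq ht]
      exact hRS t ht
  have hcont : ∀ w, ContinuousOn (iteratedIntegral X a w) (Icc a b) := by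
    intro w
    induction w using List.reverseRecOn with
    | nil => exact continuousOn_const
    | append_singleton w i ih => exact (step w ih i).2.1.continuousOn
  exact ⟨hcont w, step w (hcont w)⟩

/-! ### Letter derivatives and brackets of series -/

namespace NCSeries

variable {d : ℕ}

/-- The series `∂ᵢ x` with `x = x₀ + ∑ᵢ eᵢ ∂ᵢ x`. -/
def headDeriv (i : Fin d) (x : NCSeries d) : NCSeries d := ofCoeff fun w => x.coeff (i :: w)

/-- The series `xᵢ` with `x = x₀ + ∑ᵢ xᵢ eᵢ`. -/
def lastDeriv (i : Fin d) (x : NCSeries d) : NCSeries d := ofCoeff fun w => x.coeff (w ++ [i])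

@[simp] theorem coeff_headDeriv (i : Fin d) (x : NCSeries d) (w : List (Fin d)) :
    (headDeriv i x).coeff w = x.coeff (i :: w) := rfl

@[simp] theorem coeff_lastDeriv (i : Fin d) (x : NCSeries d) (w : List (Fin d)) :
    (lastDeriv i x).coeff w = x.coeff (w ++ [i]) := rfl

theorem headDeriv_mul (i : Fin d) (x y : NCSeries d) :
    headDeriv i (x * y) = x.coeff [] • headDeriv i y + headDeriv i x * y := by
  ext w
  rw [coeff_headDeriv, coeff_mul_cons]
  rfl

theorem coeff_mul_concat (x y : NCSeries d) (w : List (Fin d)) (i : Fin d) :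
    (x * y).coeff (w ++ [i]) =
      (x * lastDeriv i y).coeff w + x.coeff (w ++ [i]) * y.coeff [] := by
  rw [coeff_mul, coeff_mul, List.length_append, List.length_singleton, Finset.sum_range_succ]
  congr 1
  · refine Finset.sum_congr rfl fun k hk => ?_
    have hk' : k ≤ w.length := Nat.lt_succ_iff.mp (Finset.mem_range.mp hk)
    rw [List.take_append_of_le_length hk', List.drop_append_of_le_length hk', coeff_lastDeriv]
  · rw [List.take_of_length_le (by simp), List.drop_of_length_le (by simp)]

theorem lastDeriv_mul (i : Fin d) (x y : NCSeries d) :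
    lastDeriv i (x * y) = x * lastDeriv i y + y.coeff [] • lastDeriv i x := by
  ext w
  rw [coeff_lastDeriv, coeff_mul_concat, coeff_add, coeff_smul, coeff_lastDeriv]
  ring

theorem lastDeriv_one (i : Fin d) : lastDeriv i (1 : NCSeries d) = 0 := by
  ext w
  simp [coeff_one]

theorem coeff_e (i : Fin d) (w : List (Fin d)) : (e i).coeff w = if w = [i] then 1 else 0 := rfl

@[simp] theorem coeff_e_nil (i : Fin d) : (e i).coeff [] = 0 := by simp [coeff_e]

theorem lastDeriv_e (i j : Fin d) : lastDeriv i (e j) = if i = j then 1 else 0 := by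
  ext w
  rw [coeff_lastDeriv, coeff_e]
  split_ifs with h1 h2 h2
  · obtain rfl : w = [] := by simpa using congrArg List.length h1
    simp [coeff_one]
  · obtain rfl : w = [] := by simpa using congrArg List.length h1
    simp_all
  · subst h2
    rw [coeff_one, if_neg]
    rintro rfl
    simp at h1
  · simp

theorem lastDeriv_mul_e (i j : Fin d) (x : NCSeries d) :
    lastDeriv i (x * e j) = if i = j then x else 0 := by
  rw [lastDeriv_mul, lastDeriv_e]
  split_ifs <;> simp

theorem headDeriv_e (i j : Fin d) : headDeriv i (e j) = if i = j then 1 else 0 := by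
  ext w
  rw [coeff_headDeriv, coeff_e]
  split_ifs with h1 h2 h2 <;> simp_all [coeff_one]

theorem coeff_mul_congr {x x' y y' : NCSeries d} {w : List (Fin d)}
    (hx : ∀ v, v.length ≤ w.length → x.coeff v = x'.coeff v)
    (hy : ∀ v, v.length ≤ w.length → y.coeff v = y'.coeff v) :
    (x * y).coeff w = (x' * y').coeff w := by
  rw [coeff_mul, coeff_mul]
  refine Finset.sum_congr rfl fun k _ => ?_
  rw [hx _ (by simp), hy _ (by simp)]

/-- Bracketing with a letter raises degree by exactly one. This makes the recursions through `⁅e i,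
·⁆` below well-founded, one coefficient at a time. -/
theorem coeff_lie_e_congr {i : Fin d} {x y : NCSeries d} {w : List (Fin d)}
    (h : ∀ v, v.length + 1 = w.length → x.coeff v = y.coeff v) :
    ⁅e i, x⁆.coeff w = ⁅e i, y⁆.coeff w := by
  rw [Ring.lie_def, Ring.lie_def, coeff_sub, coeff_sub, coeff_mul, coeff_mul, coeff_mul, coeff_mul]
  congr 1
  · refine Finset.sum_congr rfl fun k hk => ?_
    have hk' : k ≤ w.length := Nat.lt_succ_iff.mp (Finset.mem_range.mp hk)
    by_cases h1 : w.take k = [i]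
    · have := congrArg List.length h1
      rw [h _ ?_]
      simp at this ⊢
      omega
    · simp [coeff_e, h1]
  · refine Finset.sum_congr rfl fun k hk => ?_
    have hk' : k ≤ w.length := Nat.lt_succ_iff.mp (Finset.mem_range.mp hk)
    by_cases h1 : w.drop k = [i]
    · have := congrArg List.length h1
      rw [h _ ?_]
      simp at this ⊢
      omega
    · simp [coeff_e, h1]

theorem coeff_lie_e_nil (i : Fin d) (x : NCSeries d) : ⁅e i, x⁆.coeff [] = 0 := by
  simp [Ring.lie_def, coeff_mul_nil]

theorem lie_add_right (x y z : NCSeries d) : ⁅x, y + z⁆ = ⁅x, y⁆ + ⁅x, z⁆ := by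
  simp only [Ring.lie_def, mul_add, add_mul]
  abel

theorem lie_smul_right (r : ℝ) (x y : NCSeries d) : ⁅x, r • y⁆ = r • ⁅x, y⁆ := by
  rw [Ring.lie_def, Ring.lie_def, mul_smul_comm, smul_mul_assoc, smul_sub]

@[simp] theorem lie_zero_right (x : NCSeries d) : ⁅x, (0 : NCSeries d)⁆ = 0 := by
  simp [Ring.lie_def]

theorem lie_sum_right {ι : Type*} (s : Finset ι) (x : NCSeries d) (f : ι → NCSeries d) :
    ⁅x, ∑ i ∈ s, f i⁆ = ∑ i ∈ s, ⁅x, f i⁆ := by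
  simp only [Ring.lie_def, Finset.mul_sum, Finset.sum_mul, Finset.sum_sub_distrib]

/-! ### The adjoint action -/

/-- Approximation of `adjoint` by words of length `< n`. -/
noncomputable def adjointAux : ℕ → NCSeries d → NCSeries d → NCSeries d
  | 0, _, _ => 0
  | n + 1, x, y => x.coeff [] • y + ∑ i, ⁅e i, adjointAux n (headDeriv i x) y⁆

theorem coeff_adjointAux_stable {m n : ℕ} {w : List (Fin d)} (hm : w.length < m)
    (hn : w.length < n) (x y : NCSeries d) :
    (adjointAux m x y).coeff w = (adjointAux n x y).coeff w := by
  induction m generalizing n w x with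
  | zero => omega
  | succ m ih =>
    cases n with
    | zero => omega
    | succ n =>
      simp only [adjointAux, coeff_add, coeff_sum]
      congr 1
      exact Finset.sum_congr rfl fun i _ =>
        coeff_lie_e_congr fun v hv => ih (by omega) (by omega) _

/-- The adjoint action `∑ x_{i₁,…,i_k} [e_{i₁}, [e_{i₂}, … [e_{i_k}, y] …]]` of `x` on `y`. -/
noncomputable def adjoint (x y : NCSeries d) : NCSeries d :=
  ofCoeff fun w => (adjointAux (w.length + 1) x y).coeff w

theorem coeff_adjoint {n : ℕ} {w : List (Fin d)} (h : w.length < n) (x y : NCSeries d) :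
    (adjoint x y).coeff w = (adjointAux n x y).coeff w :=
  coeff_adjointAux_stable (Nat.lt_succ_self _) h x y

theorem adjoint_eq (x y : NCSeries d) :
    adjoint x y = x.coeff [] • y + ∑ i, ⁅e i, adjoint (headDeriv i x) y⁆ := by
  ext w
  rw [coeff_adjoint (Nat.lt_succ_self w.length)]
  simp only [adjointAux, coeff_add, coeff_sum]
  congr 1
  exact Finset.sum_congr rfl fun i _ => coeff_lie_e_congr fun v hv =>
    (coeff_adjoint (by omega) _ _).symm

/-- Coefficient-wise induction along the recursion `adjoint_eq`. -/
theorem ext_of_lie_recursion {ι : Type*} {F G : ι → NCSeries d} {p : ι → NCSeries d}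
    {σ : Fin d → ι → ι} (hF : ∀ a, F a = p a + ∑ i, ⁅e i, F (σ i a)⁆)
    (hG : ∀ a, G a = p a + ∑ i, ⁅e i, G (σ i a)⁆) (a : ι) : F a = G a := by
  ext w
  induction hn : w.length using Nat.strong_induction_on generalizing w a with
  | _ n ih =>
    rw [hF, hG]
    simp only [coeff_add, coeff_sum]
    congr 1
    exact Finset.sum_congr rfl fun i _ => coeff_lie_e_congr fun v hv => ih _ (by omega) _ _ rfl

theorem adjoint_add_left (x x' y : NCSeries d) :
    adjoint (x + x') y = adjoint x y + adjoint x' y := by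
  -- The recursion runs over pairs, as both summands are differentiated together.
  refine ext_of_lie_recursion (ι := NCSeries d × NCSeries d)
    (F := fun a => adjoint (a.1 + a.2) y) (G := fun a => adjoint a.1 y + adjoint a.2 y)
    (p := fun a => (a.1.coeff [] + a.2.coeff []) • y)
    (σ := fun i a => (headDeriv i a.1, headDeriv i a.2)) ?_ ?_ (x, x')
  · exact fun a => adjoint_eq _ _
  · intro a
    dsimp only
    rw [adjoint_eq a.1, adjoint_eq a.2]
    simp only [lie_add_right, Finset.sum_add_distrib, add_smul]
    abel

theorem adjoint_smul_left (r : ℝ) (x y : NCSeries d) : adjoint (r • x) y = r • adjoint x y := by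
  refine ext_of_lie_recursion (F := fun x => adjoint (r • x) y) (G := fun x => r • adjoint x y)
    (p := fun x => (r * x.coeff []) • y) (σ := headDeriv) ?_ ?_ x
  · exact fun x => adjoint_eq _ _
  · intro x
    rw [adjoint_eq x, smul_add, smul_smul, Finset.smul_sum]
    simp only [lie_smul_right]

theorem adjoint_add_right (x y y' : NCSeries d) :
    adjoint x (y + y') = adjoint x y + adjoint x y' := by
  refine ext_of_lie_recursion (F := fun x => adjoint x (y + y'))
    (G := fun x => adjoint x y + adjoint x y') (p := fun x => x.coeff [] • (y + y'))
    (σ := headDeriv) ?_ ?_ x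
  · exact fun x => adjoint_eq _ _
  · intro x
    rw [adjoint_eq x, adjoint_eq x y']
    simp only [lie_add_right, Finset.sum_add_distrib, smul_add]
    abel

theorem adjoint_zero_left (y : NCSeries d) : adjoint 0 y = 0 := by
  simpa using adjoint_smul_left 0 0 y

theorem headDeriv_one (i : Fin d) : headDeriv i (1 : NCSeries d) = 0 := by
  ext w
  simp [coeff_one]

theorem adjoint_one (y : NCSeries d) : adjoint 1 y = y := by
  rw [adjoint_eq]
  simp [headDeriv_one, adjoint_zero_left, coeff_one]

theorem adjoint_e (i : Fin d) (y : NCSeries d) : adjoint (e i) y = ⁅e i, y⁆ := by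
  rw [adjoint_eq, Finset.sum_eq_single i]
  · simp [headDeriv_e, adjoint_one]
  · intro j _ hj
    simp [headDeriv_e, hj, adjoint_zero_left]
  · simp

/-- As functions of $x$ both sides obey one recursion with inhomogeneity $x_0\cdot$ `adjoint x' y`,
by the Leibniz rule for `headDeriv`. -/
theorem adjoint_mul (x x' y : NCSeries d) : adjoint (x * x') y = adjoint x (adjoint x' y) := by
  refine ext_of_lie_recursion (F := fun x => adjoint (x * x') y)
    (G := fun x => adjoint x (adjoint x' y)) (p := fun x => x.coeff [] • adjoint x' y)
    (σ := headDeriv) ?_ ?_ x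
  · intro x
    rw [adjoint_eq (x * x'), adjoint_eq x' y, coeff_mul_nil]
    simp only [headDeriv_mul, adjoint_add_left, adjoint_smul_left, lie_add_right, lie_smul_right,
      Finset.sum_add_distrib, smul_add, smul_smul, Finset.smul_sum]
    abel
  · exact fun x => adjoint_eq _ _

theorem coeff_adjoint_eq_zero {m : ℕ} {y : NCSeries d} (hy : ∀ w, w.length < m → y.coeff w = 0)
    {w : List (Fin d)} (hw : w.length < m) (x : NCSeries d) : (adjoint x y).coeff w = 0 := by
  induction hn : w.length using Nat.strong_induction_on generalizing w x with
  | _ n ih =>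
    rw [adjoint_eq, coeff_add, coeff_smul, hy w hw, coeff_sum, mul_zero, zero_add]
    refine Finset.sum_eq_zero fun i _ => ?_
    rw [coeff_lie_e_congr (y := 0) fun v hv => ih _ (by omega) (by omega) _ rfl, lie_zero_right,
      coeff_zero]

/-! ### The Dynkin operator and the Dynkin–Specht–Wever criterion -/

/-- The linear map that sends the monomial of a word to its right-nested bracket. -/
noncomputable def dynkin (x : NCSeries d) : NCSeries d := ∑ i, adjoint (lastDeriv i x) (e i)

/-- The derivation that multiplies monomials of length `k` by `k`. -/
noncomputable def euler (x : NCSeries d) : NCSeries d := ofCoeff fun w => w.length * x.coeff w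

@[simp] theorem coeff_euler (x : NCSeries d) (w : List (Fin d)) :
    (euler x).coeff w = w.length * x.coeff w := rfl

theorem euler_mul (x y : NCSeries d) : euler (x * y) = euler x * y + x * euler y := by
  ext w
  rw [coeff_euler, coeff_add, coeff_mul, coeff_mul, coeff_mul, Finset.mul_sum,
    ← Finset.sum_add_distrib]
  refine Finset.sum_congr rfl fun k hk => ?_
  have hk' : k ≤ w.length := Nat.lt_succ_iff.mp (Finset.mem_range.mp hk)
  have : (w.length : ℝ) = (w.take k).length + (w.drop k).length := by
    rw [← Nat.cast_add, ← List.length_append, List.take_append_drop]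
  rw [this, coeff_euler, coeff_euler]
  ring

theorem euler_one : euler (1 : NCSeries d) = 0 := by
  ext w
  by_cases h : w = [] <;> simp [coeff_one, h]

theorem euler_e (i : Fin d) : euler (e i) = e i := by
  ext w
  by_cases h : w = [i] <;> simp [coeff_e, h]

theorem lastDeriv_add (i : Fin d) (x y : NCSeries d) :
    lastDeriv i (x + y) = lastDeriv i x + lastDeriv i y := rfl

theorem lastDeriv_smul (i : Fin d) (r : ℝ) (x : NCSeries d) :
    lastDeriv i (r • x) = r • lastDeriv i x := rfl

theorem dynkin_add (x y : NCSeries d) : dynkin (x + y) = dynkin x + dynkin y := by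
  simp only [dynkin, lastDeriv_add, adjoint_add_left, Finset.sum_add_distrib]

theorem dynkin_smul (r : ℝ) (x : NCSeries d) : dynkin (r • x) = r • dynkin x := by
  simp only [dynkin, lastDeriv_smul, adjoint_smul_left, Finset.smul_sum]

theorem dynkin_one : dynkin (1 : NCSeries d) = 0 := by
  simp [dynkin, lastDeriv_one, adjoint_zero_left]

theorem adjoint_sum_right {ι : Type*} (s : Finset ι) (x : NCSeries d) (f : ι → NCSeries d) :
    adjoint x (∑ i ∈ s, f i) = ∑ i ∈ s, adjoint x (f i) :=
  map_sum (AddMonoidHom.mk' (adjoint x) (adjoint_add_right x)) f s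

theorem dynkin_sum {ι : Type*} (s : Finset ι) (f : ι → NCSeries d) :
    dynkin (∑ i ∈ s, f i) = ∑ i ∈ s, dynkin (f i) :=
  map_sum (AddMonoidHom.mk' dynkin dynkin_add) f s

/-- When $y$ ends in a letter, the bracket of a concatenation is $x$ acting on the bracket of $y$;
the constant term of $y$ leaves only the bracket of $x$. -/
theorem dynkin_mul (x y : NCSeries d) :
    dynkin (x * y) = adjoint x (dynkin y) + y.coeff [] • dynkin x := by
  simp only [dynkin, lastDeriv_mul, adjoint_add_left, adjoint_mul, adjoint_smul_left,
    Finset.sum_add_distrib, adjoint_sum_right, Finset.smul_sum]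

theorem dynkin_mul_e (x : NCSeries d) (i : Fin d) : dynkin (x * e i) = adjoint x (e i) := by
  rw [dynkin, Finset.sum_eq_single i]
  · simp [lastDeriv_mul_e]
  · intro j _ hj
    simp [lastDeriv_mul_e, hj, adjoint_zero_left]
  · simp

theorem dynkin_eq (x : NCSeries d) :
    dynkin x = ∑ i, x.coeff [i] • e i + ∑ i, ⁅e i, dynkin (headDeriv i x)⁆ := by
  have h : ∀ i j : Fin d, headDeriv i (lastDeriv j x) = lastDeriv j (headDeriv i x) :=
    fun _ _ => rfl
  simp only [dynkin]
  rw [Finset.sum_congr rfl fun j _ => adjoint_eq (lastDeriv j x) (e j), Finset.sum_add_distrib,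
    Finset.sum_comm]
  simp only [h, lie_sum_right]
  rfl

theorem liePolynomial_zero (c : List (Fin d) → ℝ) : liePolynomial c 0 = 0 := by
  simp [liePolynomial, nestedBracket]

/-- Words are split at their first letter. Degree one is separate, since $e_i$ is not a bracket with
the junk value `nestedBracket [] = 0`. -/
theorem liePolynomial_succ (c : List (Fin d) → ℝ) (k : ℕ) :
    liePolynomial c (k + 1) = (if k = 0 then ∑ i, c [i] • e i else 0) +
      ∑ i, ⁅e i, liePolynomial (fun w => c (i :: w)) k⁆ := by
  have h : liePolynomial c (k + 1) = ∑ i : Fin d, ∑ f : Fin k → Fin d,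
      c (i :: List.ofFn f) • nestedBracket (i :: List.ofFn f) := by
    rw [liePolynomial, ← (Fin.consEquiv fun _ => Fin d).sum_comp, Fintype.sum_prod_type]
    simp [Fin.consEquiv, List.ofFn_succ]
  rw [h]
  cases k with
  | zero => simp [liePolynomial_zero, nestedBracket]
  | succ k =>
    rw [if_neg (Nat.succ_ne_zero k), zero_add]
    refine Finset.sum_congr rfl fun i _ => ?_
    rw [liePolynomial, lie_sum_right]
    refine Finset.sum_congr rfl fun f _ => ?_
    rw [lie_smul_right, List.ofFn_succ, nestedBracket]

theorem coeff_dynkin (x : NCSeries d) (w : List (Fin d)) :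
    (dynkin x).coeff w = (liePolynomial x.coeff w.length).coeff w := by
  induction hn : w.length generalizing x w with
  | zero =>
    obtain rfl := List.length_eq_zero_iff.mp hn
    rw [dynkin_eq, liePolynomial_zero]
    simp [coeff_sum, coeff_lie_e_nil]
  | succ n ih =>
    rw [dynkin_eq, liePolynomial_succ, coeff_add, coeff_add, coeff_sum _ fun i => ⁅e i, _⁆,
      coeff_sum _ fun i => ⁅e i, _⁆]
    congr 1
    · split_ifs with h
      · rfl
      · rw [coeff_sum]
        refine Finset.sum_eq_zero fun i _ => ?_
        rw [coeff_smul, coeff_e, if_neg, mul_zero]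
        rintro rfl
        simp at hn
        omega
    · exact Finset.sum_congr rfl fun i _ => coeff_lie_e_congr fun v hv =>
        ih (headDeriv i x) v (by omega)

theorem coeff_lieSeries (c : List (Fin d) → ℝ) (w : List (Fin d)) :
    (lieSeries c).coeff w = (liePolynomial c w.length).coeff w := by
  have h0 : ∀ k, k ≠ w.length → (liePolynomial c k).coeff w = 0 := by
    intro k hk
    simp only [liePolynomial, coeff_sum, coeff_smul]
    refine Finset.sum_eq_zero fun i _ => ?_
    rw [coeff_nestedBracket_eq_zero _ _ (by simpa using hk.symm), mul_zero]
  rw [lieSeries, formalSum, coeff_ofCoeff]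
  cases hn : w.length with
  | zero =>
    rw [liePolynomial_zero, coeff_zero]
    exact finsum_eq_zero_of_forall_eq_zero fun n => h0 _ (by omega)
  | succ n => exact finsum_eq_single _ n fun k hk => h0 _ (by omega)

/-- The Dynkin–Specht–Wever criterion. -/
theorem eq_lieSeries_of_dynkin_eq_euler {x : NCSeries d} (h0 : x.coeff [] = 0)
    (h : dynkin x = euler x) : ∃ c, x = lieSeries c := by
  -- In degree $k$ the hypothesis reads $D(x_k)=k\,x_k$, so $x_k=D(x_k)/k$. In degree zero, where
  -- the inverse is $0$, `h0` is used.
  refine ⟨fun w => (w.length : ℝ)⁻¹ * x.coeff w, ?_⟩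
  ext w
  rw [coeff_lieSeries]
  have h1 : liePolynomial (fun v => (v.length : ℝ)⁻¹ * x.coeff v) w.length =
      (w.length : ℝ)⁻¹ • liePolynomial x.coeff w.length := by
    rw [liePolynomial, liePolynomial, Finset.smul_sum]
    exact Finset.sum_congr rfl fun i _ => by rw [smul_smul, List.length_ofFn]
  rw [h1, coeff_smul, ← coeff_dynkin, h, coeff_euler]
  rcases eq_or_ne w [] with rfl | hw
  · simp [h0]
  · have : (w.length : ℝ) ≠ 0 := by simpa using hw
    field_simp

/-! ### Series with $D(g)g=E(g)$ -/

/-- A series `g` whose adjoint action is conjugation and that satisfies `D(g) g = E(g)`: this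
holds for group-like series and is closed under products. -/
structure IsDynkinGroupLike (g : NCSeries d) : Prop where
  coeff_nil : g.coeff [] = 1
  adjoint_mul_self : ∀ y, adjoint g y * g = g * y
  dynkin_mul_self : dynkin g * g = euler g

namespace IsDynkinGroupLike

theorem one : IsDynkinGroupLike (1 : NCSeries d) :=
  ⟨by simp [coeff_one], by simp [adjoint_one], by simp [dynkin_one, euler_one]⟩

/-- Conjugations compose, and $D(gh)gh=gD(h)h+D(g)gh=gE(h)+E(g)h=E(gh)$. -/
theorem mul {g h : NCSeries d} (hg : IsDynkinGroupLike g) (hh : IsDynkinGroupLike h) :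
    IsDynkinGroupLike (g * h) := by
  refine ⟨by rw [coeff_mul_nil, hg.coeff_nil, hh.coeff_nil, mul_one], fun y => ?_, ?_⟩
  · rw [adjoint_mul, ← mul_assoc, hg.adjoint_mul_self, mul_assoc, hh.adjoint_mul_self, mul_assoc]
  · rw [dynkin_mul, hh.coeff_nil, one_smul, add_mul, ← mul_assoc, hg.adjoint_mul_self, mul_assoc,
      hh.dynkin_mul_self, ← mul_assoc, hg.dynkin_mul_self, euler_mul, add_comm]

theorem pow {g : NCSeries d} (hg : IsDynkinGroupLike g) (n : ℕ) : IsDynkinGroupLike (g ^ n) := by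
  induction n with
  | zero => simpa using one
  | succ n ih => simpa [pow_succ] using ih.mul hg

end IsDynkinGroupLike

end NCSeries

/-! ### Differentials of series-valued functions -/

/-- The coefficient-wise version of `HasStieltjesDifferential` for series-valued functions. -/
def HasSeriesDifferential {d : ℕ} (X : ℝ → EuclideanSpace ℝ (Fin d)) (V : ℝ → ℝ) (a b : ℝ)
    (G : ℝ → NCSeries d) (G' : Fin d → ℝ → NCSeries d) : Prop :=
  ∀ w, HasStieltjesDifferential X V a b (fun t => (G t).coeff w) fun j t => (G' j t).coeff w

namespace HasSeriesDifferential

open NCSeries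

variable {d : ℕ} {X : ℝ → EuclideanSpace ℝ (Fin d)} {V : ℝ → ℝ} {a b : ℝ}
  {G H : ℝ → NCSeries d} {G' H' : Fin d → ℝ → NCSeries d}

theorem congr_right (hG : HasSeriesDifferential X V a b G G')
    (h : ∀ j, ∀ t ∈ Icc a b, H' j t = G' j t) : HasSeriesDifferential X V a b G H' :=
  fun w => (hG w).congr (fun _ _ => rfl) fun j t ht => by simp only [h j t ht]

theorem const (hV : MonotoneOn V (Icc a b)) (x : NCSeries d) :
    HasSeriesDifferential X V a b (fun _ => x) fun _ _ => 0 :=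
  fun w => HasStieltjesDifferential.const hV (x.coeff w)

theorem add (hG : HasSeriesDifferential X V a b G G') (hH : HasSeriesDifferential X V a b H H') :
    HasSeriesDifferential X V a b (fun t => G t + H t) fun j t => G' j t + H' j t :=
  fun w => (hG w).add (hH w)

theorem sub (hV : MonotoneOn V (Icc a b)) (hG : HasSeriesDifferential X V a b G G')
    (hH : HasSeriesDifferential X V a b H H') :
    HasSeriesDifferential X V a b (fun t => G t - H t) fun j t => G' j t - H' j t :=
  fun w => ((hG w).add ((hH w).const_mul hV (-1))).congr
    (fun t _ => by simp only [coeff_sub]; ring) fun j t _ => by simp only [coeff_sub]; ring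

theorem mul (hV : MonotoneOn V (Icc a b)) (hG : HasSeriesDifferential X V a b G G')
    (hH : HasSeriesDifferential X V a b H H') :
    HasSeriesDifferential X V a b (fun t => G t * H t) fun j t => G' j t * H t + G t * H' j t :=
  fun w => (HasStieltjesDifferential.sum hV (Finset.range (w.length + 1))
    fun k _ => (hG (w.take k)).mul hV (hH (w.drop k))).congr (fun t _ => rfl)
      fun j t _ => by simp only [coeff_add, coeff_mul, Finset.sum_add_distrib]

theorem sum (hV : MonotoneOn V (Icc a b)) {ι : Type*} (s : Finset ι) {F : ι → ℝ → NCSeries d}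
    {F' : ι → Fin d → ℝ → NCSeries d} (h : ∀ i ∈ s, HasSeriesDifferential X V a b (F i) (F' i)) :
    HasSeriesDifferential X V a b (fun t => ∑ i ∈ s, F i t) fun j t => ∑ i ∈ s, F' i j t :=
  fun w => (HasStieltjesDifferential.sum hV s fun i hi => h i hi w).congr
    (fun t _ => by simp only [coeff_sum]) fun j t _ => by simp only [coeff_sum]

theorem lie_left (hV : MonotoneOn V (Icc a b)) (hG : HasSeriesDifferential X V a b G G')
    (x : NCSeries d) :
    HasSeriesDifferential X V a b (fun t => ⁅x, G t⁆) fun j t => ⁅x, G' j t⁆ := by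
  simp only [Ring.lie_def]
  exact (((const hV x).mul hV hG).sub hV (hG.mul hV (const hV x))).congr_right
    fun j t _ => by simp

theorem headDeriv (hG : HasSeriesDifferential X V a b G G') (i : Fin d) :
    HasSeriesDifferential X V a b (fun t => headDeriv i (G t)) fun j t => headDeriv i (G' j t) :=
  fun w => hG (i :: w)

theorem lastDeriv (hG : HasSeriesDifferential X V a b G G') (i : Fin d) :
    HasSeriesDifferential X V a b (fun t => lastDeriv i (G t)) fun j t => lastDeriv i (G' j t) :=
  fun w => hG (w ++ [i])

theorem euler (hV : MonotoneOn V (Icc a b)) (hG : HasSeriesDifferential X V a b G G') :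
    HasSeriesDifferential X V a b (fun t => euler (G t)) fun j t => euler (G' j t) :=
  fun w => (hG w).const_mul hV w.length

/-- At fixed $n$ and $y$ this is a linear operation built from finitely many brackets with letters,
so it commutes with differentiation. -/
theorem adjointAux (hV : MonotoneOn V (Icc a b)) (hG : HasSeriesDifferential X V a b G G')
    (n : ℕ) (y : NCSeries d) :
    HasSeriesDifferential X V a b (fun t => adjointAux n (G t) y)
      fun j t => adjointAux n (G' j t) y := by
  induction n generalizing G G' with
  | zero => exact const hV 0
  | succ n ih =>
    refine HasSeriesDifferential.add (fun w => ?_)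
      (sum hV _ fun i _ => (ih (hG.headDeriv i)).lie_left hV (e i))
    exact ((hG []).const_mul hV (y.coeff w)).congr
      (fun t _ => mul_comm _ _) fun j t _ => mul_comm _ _

theorem adjoint (hV : MonotoneOn V (Icc a b)) (hG : HasSeriesDifferential X V a b G G')
    (y : NCSeries d) :
    HasSeriesDifferential X V a b (fun t => adjoint (G t) y) fun j t => adjoint (G' j t) y :=
  fun w => hG.adjointAux hV (w.length + 1) y w

theorem dynkin (hV : MonotoneOn V (Icc a b)) (hG : HasSeriesDifferential X V a b G G') :
    HasSeriesDifferential X V a b (fun t => dynkin (G t)) fun j t => dynkin (G' j t) :=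
  sum hV _ fun i _ => (hG.lastDeriv i).adjoint hV (e i)

end HasSeriesDifferential

/-! ### The equation $dS=S\,dX$ -/

namespace NCSeries

variable {d : ℕ}

theorem coeff_mul_e_eq_zero {x : NCSeries d} {w : List (Fin d)}
    (h : ∀ v, v.length < w.length → x.coeff v = 0) (j : Fin d) : (x * e j).coeff w = 0 := by
  rcases List.eq_nil_or_concat w with rfl | ⟨v, i, rfl⟩
  · simp [coeff_mul_nil]
  · rw [List.concat_eq_append, ← coeff_lastDeriv, lastDeriv_mul_e]
    split_ifs
    · exact h v (by simp)
    · rfl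

variable {X : ℝ → EuclideanSpace ℝ (Fin d)} {V : ℝ → ℝ} {a b : ℝ} {S : ℝ → NCSeries d}

/-- A solution of `dS = S dX` with initial value `1` acts by conjugation. -/
theorem adjoint_mul_self_of_hasSeriesDifferential (hV : MonotoneOn V (Icc a b)) (ha : S a = 1)
    (hS : HasSeriesDifferential X V a b S fun j t => S t * e j) (y : NCSeries d) {t : ℝ}
    (ht : t ∈ Icc a b) : adjoint (S t) y * S t = S t * y := by
  -- With $U_y$ the difference of the two sides, $dU_y=\sum_j(U_{[e_j,y]}+U_y e_j)\,dX^j$.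
  have hd : ∀ y, HasSeriesDifferential X V a b (fun t => adjoint (S t) y * S t - S t * y)
      fun j t => (adjoint (S t) ⁅e j, y⁆ * S t - S t * ⁅e j, y⁆) +
        (adjoint (S t) y * S t - S t * y) * e j := fun y =>
    (((hS.adjoint hV y).mul hV hS).sub hV (hS.mul hV (HasSeriesDifferential.const hV y))).congr_right
      fun j t _ => by
        simp only [adjoint_mul, adjoint_e, Ring.lie_def]
        noncomm_ring
  -- Here $m$ bounds the lowest degree of $y$ from below and $k$ is the excess. Passing to $[e_j,y]$
  -- trades one unit of $k$ for one of $m$; $U_y e_j$ involves only shorter words. For $k=0$ both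
  -- products vanish in the degree considered.
  have key : ∀ k m (y : NCSeries d) w, (∀ v, v.length < m → y.coeff v = 0) → w.length < m + k →
      ∀ t ∈ Icc a b, (adjoint (S t) y * S t - S t * y).coeff w = 0 := by
    intro k
    induction k with
    | zero =>
      intro m y w hy hw t _
      rw [coeff_sub, coeff_mul, coeff_mul, Finset.sum_eq_zero, Finset.sum_eq_zero, sub_zero]
      · intro k _
        rw [hy _ (by simp; omega), mul_zero]
      · intro k _
        rw [coeff_adjoint_eq_zero hy (by simp; omega), zero_mul]
    | succ k ih =>
      intro m y w hy hw t ht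
      have h0 := (hd y w).eq_of_zero hV (fun j s hs => ?_) ht
      · dsimp only at h0
        rw [h0, ha, adjoint_one, mul_one, one_mul, sub_self, coeff_zero]
      · rw [coeff_add, ih (m + 1) _ w ?_ (by omega) s hs, zero_add]
        · exact coeff_mul_e_eq_zero (fun v hv => ih m y v hy (by omega) s hs) j
        · intro v hv
          rw [coeff_lie_e_congr (y := 0) fun u hu => hy u (by omega), lie_zero_right, coeff_zero]
  rw [← sub_eq_zero]
  ext w
  exact key (w.length + 1) 0 y w (by simp) (by omega) t ht

/-- By the conjugation identity, $D(S e_j)S=S e_j$ cancels the term $S\,E(e_j)$ of $E(S e_j)$. So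
the difference $U$ satisfies $dU=U\,dX$, $U_a=0$, and vanishes by induction on word length. -/
theorem dynkin_mul_self_of_hasSeriesDifferential (hV : MonotoneOn V (Icc a b)) (ha : S a = 1)
    (hS : HasSeriesDifferential X V a b S fun j t => S t * e j) {t : ℝ}
    (ht : t ∈ Icc a b) : dynkin (S t) * S t = euler (S t) := by
  have hd : HasSeriesDifferential X V a b (fun t => dynkin (S t) * S t - euler (S t))
      fun j t => (dynkin (S t) * S t - euler (S t)) * e j :=
    (((hS.dynkin hV).mul hV hS).sub hV (hS.euler hV)).congr_right fun j t ht => by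
      rw [dynkin_mul_e, adjoint_mul_self_of_hasSeriesDifferential hV ha hS _ ht, euler_mul, euler_e]
      noncomm_ring
  rw [← sub_eq_zero]
  ext w
  induction hn : w.length using Nat.strong_induction_on generalizing w t with
  | _ n ih =>
    rw [(hd w).eq_of_zero hV (fun j s hs => ?_) ht]
    · simp [ha, dynkin_one, euler_one]
    · exact coeff_mul_e_eq_zero (fun v hv => ih _ (by omega) hs v rfl) j

theorem isDynkinGroupLike_of_hasSeriesDifferential (hV : MonotoneOn V (Icc a b)) (ha : S a = 1)
    (hS : HasSeriesDifferential X V a b S fun j t => S t * e j) {t : ℝ}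
    (ht : t ∈ Icc a b) : IsDynkinGroupLike (S t) := by
  refine ⟨?_, fun y => adjoint_mul_self_of_hasSeriesDifferential hV ha hS y ht,
    dynkin_mul_self_of_hasSeriesDifferential hV ha hS ht⟩
  rw [(hS []).eq_of_zero hV (fun j s _ => by simp [coeff_mul_nil]) ht, ha, coeff_one, if_pos rfl]

/-! ### The logarithm as the linear term of $x^N$ -/

open Polynomial in
/-- The polynomial `N ↦ N (N - 1) ⋯ (N - n + 1) / n!`. -/
noncomputable def choosePolynomial : ℕ → ℝ[X]
  | 0 => 1
  | n + 1 => C ((n : ℝ) + 1)⁻¹ * (choosePolynomial n * (Polynomial.X - C (n : ℝ)))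

theorem eval_choosePolynomial (n N : ℕ) :
    (choosePolynomial n).eval (N : ℝ) = (N.choose n : ℝ) := by
  induction n with
  | zero => simp [choosePolynomial]
  | succ n ih =>
    have h : (N.choose (n + 1) : ℝ) * (n + 1) = N.choose n * (N - n) := by
      rcases le_or_gt n N with hn | hn
      · rw [← Nat.cast_sub hn]
        exact_mod_cast Nat.choose_succ_right_eq N n
      · simp [Nat.choose_eq_zero_of_lt hn, Nat.choose_eq_zero_of_lt (hn.trans (Nat.lt_succ_self n))]
    have h0 : (n : ℝ) + 1 ≠ 0 := by positivity
    simp only [choosePolynomial, Polynomial.eval_mul, Polynomial.eval_C, ih, Polynomial.eval_sub,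
      Polynomial.eval_X, ← h]
    field_simp

theorem eval_zero_choosePolynomial (n : ℕ) :
    (choosePolynomial n).eval 0 = if n = 0 then 1 else 0 := by
  have := eval_choosePolynomial n 0
  rw [Nat.cast_zero] at this
  rw [this]
  cases n <;> simp

theorem eval_zero_derivative_choosePolynomial_succ (n : ℕ) :
    (choosePolynomial (n + 1)).derivative.eval 0 = (-1) ^ n / ((n : ℝ) + 1) := by
  induction n with
  | zero => simp [choosePolynomial]
  | succ n ih =>
    have h0 : (n : ℝ) + 1 ≠ 0 := by positivity
    have h1 : (n : ℝ) + 1 + 1 ≠ 0 := by positivity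
    rw [choosePolynomial, Polynomial.derivative_C_mul, Polynomial.derivative_mul]
    simp only [Polynomial.eval_mul, Polynomial.eval_add, Polynomial.eval_C, ih,
      eval_zero_choosePolynomial]
    simp
    field_simp
    ring

theorem liePolynomial_congr {c c' : List (Fin d) → ℝ} {k : ℕ}
    (h : ∀ w, w.length = k → c w = c' w) : liePolynomial c k = liePolynomial c' k :=
  Finset.sum_congr rfl fun i _ => by rw [h _ (by simp)]

theorem coeff_dynkin_congr {x y : NCSeries d} {w : List (Fin d)}
    (h : ∀ v, v.length = w.length → x.coeff v = y.coeff v) :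
    (dynkin x).coeff w = (dynkin y).coeff w := by
  rw [coeff_dynkin, coeff_dynkin, liePolynomial_congr h]

/-- The binomial series for `xᴺ`, truncated. -/
theorem coeff_pow_eq_coeff_sum {x : NCSeries d} (hx : x.coeff [] = 1) (N m : ℕ)
    {v : List (Fin d)} (hv : v.length ≤ m) :
    (x ^ N).coeff v =
      (∑ n ∈ Finset.range (m + 1), (choosePolynomial n).eval (N : ℝ) • (x - 1) ^ n).coeff v := by
  have hq : (x - 1).coeff [] = 0 := by simp [hx, coeff_one]
  have h1 : x ^ N = ∑ n ∈ Finset.range (N + 1),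
      (choosePolynomial n).eval (N : ℝ) • (x - 1) ^ n := by
    conv_lhs => rw [← sub_add_cancel x 1, (Commute.one_right (x - 1)).add_pow]
    refine Finset.sum_congr rfl fun n _ => ?_
    rw [one_pow, mul_one, eval_choosePolynomial, ← nsmul_eq_mul', Nat.cast_smul_eq_nsmul]
  -- Truncations at $N$ and at $m$ are compared through $N+m$: beyond $N$ the binomials vanish,
  -- beyond $m$ the powers of $x-1$ have no word of length at most $m$.
  have h2 : ∀ k, N ≤ k → m ≤ k → (x ^ N).coeff v = (∑ n ∈ Finset.range (k + 1),
      (choosePolynomial n).eval (N : ℝ) • (x - 1) ^ n).coeff v := by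
    intro k hk _
    rw [h1, coeff_sum, coeff_sum]
    refine Finset.sum_subset (Finset.range_subset_range.mpr (by omega)) fun n _ hn => ?_
    rw [eval_choosePolynomial, Nat.choose_eq_zero_of_lt (by simpa using hn), Nat.cast_zero,
      zero_smul, coeff_zero]
  rw [h2 (N + m) (by omega) (by omega), coeff_sum, coeff_sum]
  refine (Finset.sum_subset (Finset.range_subset_range.mpr (by omega)) fun n _ hn => ?_).symm
  rw [coeff_smul, coeff_pow_eq_zero hq _ _ (by simp at hn; omega), mul_zero]

/-- The logarithm collects the coefficients of `N` in the binomial series for `xᴺ`. -/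
theorem coeff_log {x : NCSeries d} (hx : x.coeff [] = 1) (m : ℕ) {v : List (Fin d)}
    (hv : v.length ≤ m) :
    (log x).coeff v = (∑ n ∈ Finset.range (m + 1),
      (choosePolynomial n).derivative.eval 0 • (x - 1) ^ n).coeff v := by
  have hq : (x - 1).coeff [] = 0 := by simp [hx, coeff_one]
  rw [Finset.sum_range_succ', log, hx, Real.log_one, zero_smul, zero_add, formalSum, coeff_ofCoeff,
    coeff_add, coeff_sum, finsum_eq_sum_of_support_subset (s := Finset.range m)]
  · have h0 : (choosePolynomial 0).derivative.eval 0 = 0 := by simp [choosePolynomial]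
    simp [h0, eval_zero_derivative_choosePolynomial_succ, logTerm, hx]
  · intro n hn
    by_contra h
    refine hn ?_
    dsimp only
    rw [logTerm, hx, inv_one, one_smul, coeff_smul,
      coeff_pow_eq_zero hq _ _ (by simp at h; omega), mul_zero]

theorem IsDynkinGroupLike.dynkin_log {x : NCSeries d} (hx : IsDynkinGroupLike x) :
    dynkin (log x) = euler (log x) := by
  ext w
  set m := w.length with hm
  set q := x - 1 with hq
  -- At $N$ this is the coefficient at $w$ of $D(x^N)x^N-E(x^N)$, so every natural number is a root.
  let P : Polynomial ℝ := ∑ n ∈ Finset.range (m + 1), ∑ k ∈ Finset.range (m + 1),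
      Polynomial.C ((dynkin (q ^ n) * q ^ k).coeff w) * (choosePolynomial n * choosePolynomial k) -
    ∑ n ∈ Finset.range (m + 1), Polynomial.C (w.length * (q ^ n).coeff w) * choosePolynomial n
  have hP : P = 0 := by
    refine Polynomial.eq_zero_of_infinite_isRoot P
      ((Set.infinite_range_of_injective (Nat.cast_injective (R := ℝ))).mono ?_)
    rintro _ ⟨N, rfl⟩
    have h := congrArg (fun z => z.coeff w) (hx.pow N).dynkin_mul_self
    rw [coeff_mul_congr (fun v hv => coeff_dynkin_congr fun u hu =>
      coeff_pow_eq_coeff_sum hx.coeff_nil N m (hu.trans_le hv))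
      (fun v hv => coeff_pow_eq_coeff_sum hx.coeff_nil N m hv), coeff_euler,
      coeff_pow_eq_coeff_sum hx.coeff_nil N m le_rfl, dynkin_sum, Finset.sum_mul_sum] at h
    simp only [dynkin_smul, smul_mul_smul_comm, coeff_sum, coeff_smul, Finset.mul_sum] at h
    rw [Set.mem_ofPred_eq, Polynomial.IsRoot, Polynomial.eval_sub, sub_eq_zero]
    simp only [Polynomial.eval_finsetSum, Polynomial.eval_mul, Polynomial.eval_C]
    refine Eq.trans (Finset.sum_congr rfl fun n _ => Finset.sum_congr rfl fun k _ => ?_)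
      (h.trans (Finset.sum_congr rfl fun n _ => ?_)) <;> ring
  -- The linear term in $N$ is extracted by differentiating at $0$.
  have h := congrArg (fun p => (Polynomial.derivative p).eval 0) hP
  simp only [P, Polynomial.derivative_sub, Polynomial.derivative_sum,
    Polynomial.derivative_mul, Polynomial.derivative_C, Polynomial.eval_sub,
    Polynomial.eval_finsetSum, Polynomial.eval_mul, Polynomial.eval_add, Polynomial.eval_C,
    Polynomial.derivative_zero, Polynomial.eval_zero, eval_zero_choosePolynomial] at h
  rw [coeff_dynkin_congr fun v hv => coeff_log hx.coeff_nil m hv.le, coeff_euler,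
    coeff_log hx.coeff_nil m le_rfl, dynkin_sum]
  simp only [dynkin_smul, coeff_sum, coeff_smul, Finset.mul_sum]
  refine Eq.trans (Finset.sum_congr rfl fun n _ => ?_)
    ((sub_eq_zero.mp h).trans (Finset.sum_congr rfl fun n _ => by ring))
  -- Only $k=0$ survives: for $n,k\ge1$ both binomials vanish at $0$, and for $n=0$ the factor
  -- $D(1)$ is zero.
  rw [Finset.sum_eq_single 0]
  · rcases eq_or_ne n 0 with rfl | hn
    · simp [dynkin_one]
    · simp [hn]
      ring
  · intro k _ hk
    rcases eq_or_ne n 0 with rfl | hn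
    · simp [dynkin_one]
    · simp [hn, hk]
  · simp

end NCSeries

/-! ### The signature -/

theorem hasSeriesDifferential_signature {d : ℕ} {X X' : ℝ → EuclideanSpace ℝ (Fin d)} {a b : ℝ}
    (hab : a ≤ b) (V : StieltjesFunction ℝ) (hX' : Continuous X') (hXX' : EqOn X' X (Icc a b))
    (hV : ∀ s t, s ≤ t → ‖X' t - X' s‖ ≤ V t - V s) :
    HasSeriesDifferential X V a b (signature X a) fun j t => signature X a t * NCSeries.e j := by
  intro w
  rcases List.eq_nil_or_concat w with rfl | ⟨v, i, rfl⟩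
  · exact (HasStieltjesDifferential.const (V.mono.monotoneOn _) 1).congr (fun _ _ => rfl)
      fun j t _ => by simp [NCSeries.coeff_mul_nil]
  · rw [List.concat_eq_append]
    refine ((iteratedIntegral_spec hab V hX' hXX' hV v).2 i).2.1.congr (fun _ _ => rfl)
      fun j t _ => ?_
    dsimp only
    rw [← NCSeries.coeff_lastDeriv, NCSeries.lastDeriv_mul_e]
    by_cases h : j = i
    · subst h
      simp [signature]
    · rw [if_neg h, if_neg (Ne.symm h)]
      rfl

theorem mainTheorem4 (d : ℕ) (a b : ℝ) (hab : a ≤ b) (X : ℝ → EuclideanSpace ℝ (Fin d))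
    (hX : ContinuousOn X (Set.Icc a b)) (hXbv : BoundedVariationOn X (Set.Icc a b)) :
    (∀ (w : List (Fin d)) (i : Fin d), ∀ t ∈ Set.Icc a b,
      IsRiemannStieltjesIntegral (iteratedIntegral X a w) (fun s => X s i) a t
        (iteratedIntegral X a (w ++ [i]) t)) ∧
    ∃ c : List (Fin d) → ℝ, NCSeries.log (signature X a b) = NCSeries.lieSeries c := by
  obtain ⟨X', V, hX', hXX', hV⟩ := exists_stieltjesFunction_dominating hab hX hXbv
  have hspec := iteratedIntegral_spec hab V hX' hXX' hV
  refine ⟨fun w i t ht => ((hspec w).2 i).2.2 t ht, ?_⟩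
  have ha : signature X a a = 1 := by
    ext w
    rcases List.eq_nil_or_concat w with rfl | ⟨v, i, rfl⟩
    · rfl
    · rw [List.concat_eq_append, NCSeries.coeff_one, if_neg (by simp)]
      exact ((hspec v).2 i).1
  have hS := NCSeries.isDynkinGroupLike_of_hasSeriesDifferential (V.mono.monotoneOn _) ha
    (hasSeriesDifferential_signature hab V hX' hXX' hV) ⟨hab, le_rfl⟩
  refine NCSeries.eq_lieSeries_of_dynkin_eq_euler ?_ hS.dynkin_log
  -- Truncated at $m=0$, the logarithm keeps only the derivative of the constant polynomial $1$, so
  -- its constant term is zero.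
  rw [NCSeries.coeff_log hS.coeff_nil 0 le_rfl]
  simp [NCSeries.choosePolynomial]
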